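/- Let $k\ge 1$. A $k$-graph is a countable small category $\Lambda$ (with object set $\Lambda^0$, and source and range maps $s,r$) together with a degree functor $d:\Lambda\to\mathbb N^k$ such that every $\lambda\in\Lambda$ with $d(\lambda)=m+n$ factors uniquely as $\lambda=\mu\nu$ with $d(\mu)=m$ and $d(\nu)=n$. Composition is written so that $\mu\nu$ is defined when $s(\mu)=r(\nu)$, and objects are identified with the identity morphisms, which are the elements of degree $0$. For $v\in\Lambda^0$ and $n\in\mathbb N^k$ let $v\Lambda=\{\lambda\in\Lambda:r(\lambda)=v\}$ and $v\Lambda^n=\{\lambda\in v\Lambda: d(\lambda)=n\}$. For $0\le p\le q\le d(\lambda)$, $\lambda(p,q)$ denotes the middle factor in the unique factorization $\lambda=\lambda'\lambda(p,q)\lambda''$ with $d(\lambda')=p$, $d(\lambda(p,q))=q-p$, $d(\lambda'')=d(\lambda)-q$. Let $\Lambda$ be a $k$-graph that is row-finite (every $v\Lambda^n$ is finite) and has no sources (every $v\Lambda^n$ is nonempty). An infinite path in $\Lambda$ is a degree-preserving functor $x:\Omega_k\to\Lambda$, where $\Omega_k$ has object set $\mathbb N^k$ and one morphism $(p,q)$,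 with range $p$, source $q$ and degree $q-p$, for each pair $p\le q$; $x(n)$ is the image of the object $n$. $\Lambda$ is cofinal if for every infinite path $x$ and every $v\in\Lambda^0$ there is $n\in\mathbb N^k$ such that there is a path in $\Lambda$ with range $v$ and source $x(n)$. $\Lambda$ is aperiodic if for every $v\in\Lambda^0$ and all $m\ne n$ in $\mathbb N^k$ there is $\lambda\in v\Lambda$ with $d(\lambda)\ge m\vee n$ and $$\lambda(m,\,m+d(\lambda)-(m\vee n))\ne\lambda(n,\,n+d(\lambda)-(m\vee n)),$$ where $m\vee n$ is the pointwise maximum. Let $R$ be a nonzero commutative ring with $1$. The Kumjian–Pask algebra $\mathrm{KP}_R(\Lambda)$ is the universal associative (not necessarily unital) $R$-algebra generated by elements $p_v$ ($v\in\Lambda^0$) and $s_\lambda,s_{\lambda^*}$ ($\lambda\in\Lambda$, $d(\lambda)\neq0$) subject to the following relations: the $p_v$ are mutually orthogonal idempotents; for $\lambda,\mu$ of nonzero degree with $s(\lambda)=r(\mu)$, $s_\lambda s_\mu=s_{\lambda\mu}$ and $s_{\mu^*}s_{\lambda^*}=s_{(\lambda\mu)^*}$; for $\lambda$ of nonzero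 degree, $p_{r(\lambda)}s_\lambda=s_\lambda=s_\lambda p_{s(\lambda)}$ and $p_{s(\lambda)}s_{\lambda^*}=s_{\lambda^*}=s_{\lambda^*}p_{r(\lambda)}$; $s_{\lambda^*}s_\mu=\delta_{\lambda,\mu}p_{s(\lambda)}$ whenever $d(\lambda)=d(\mu)\ne0$; and $p_v=\sum_{\lambda\in v\Lambda^n}s_\lambda s_{\lambda^*}$ for all $v\in\Lambda^0$ and $n\in\mathbb N^k\setminus\{0\}$. A two-sided ideal $I$ of $\mathrm{KP}_R(\Lambda)$ is basic if, for $v\in\Lambda^0$ and $r\in R\setminus\{0\}$, $rp_v\in I$ implies $p_v\in I$. $\mathrm{KP}_R(\Lambda)$ is basically simple if its only basic ideals are $\{0\}$ and $\mathrm{KP}_R(\Lambda)$. **Theorem.** $\mathrm{KP}_R(\Lambda)$ is basically simple if and only if $\Lambda$ is cofinal and aperiodic. -/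

import Mathlib

open CategoryTheory

universe u w x

/-- A `k`-graph: a countable small category together with a degree functor to the additive monoid
`ℕ^k` (viewed as a category with one object), satisfying the factorization property.
A morphism `f : v ⟶ w` is a path with source `v` and range `w`, and the path written `λμ` in the
literature (with `s(λ) = r(μ)`) is the composite `μ ≫ λ`. -/
structure KGraph (k : ℕ) where
  Vertex : Type u
  [category : Category.{w} Vertex]
  countable : Countable (Σ v w : Vertex, v ⟶ w)
  degree : ∀ {v w : Vertex}, (v ⟶ w) → (Fin k → ℕ)
  degree_id : ∀ v : Vertex, degree (𝟙 v) = 0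
  degree_comp : ∀ {v u w : Vertex} (μ : v ⟶ u) (ν : u ⟶ w),
    degree (μ ≫ ν) = degree ν + degree μ
  factorization : ∀ {v w : Vertex} (f : v ⟶ w) (m n : Fin k → ℕ), degree f = m + n →
    ∃! p : Σ u : Vertex, (v ⟶ u) × (u ⟶ w),
      degree p.2.2 = m ∧ degree p.2.1 = n ∧ p.2.1 ≫ p.2.2 = f

namespace KGraph

attribute [instance] KGraph.category

variable {k : ℕ} (Λ : KGraph.{u, w} k)

/-- The set of all morphisms of the category, i.e. of all paths. -/
@[ext]
structure Path where
  src : Λ.Vertex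
  rng : Λ.Vertex
  hom : src ⟶ rng

variable {Λ} in
/-- The degree of a path. -/
def Path.deg (f : Λ.Path) : Fin k → ℕ := Λ.degree f.hom

/-- The set `vΛⁿ` of paths of degree `n` with range `v`. -/
def pathsInto (v : Λ.Vertex) (n : Fin k → ℕ) : Set Λ.Path := {f | f.rng = v ∧ f.deg = n}

/-- Every `vΛⁿ` is finite. -/
class RowFinite : Prop where
  finite : ∀ (v : Λ.Vertex) (n : Fin k → ℕ), (Λ.pathsInto v n).Finite

/-- Every `vΛⁿ` is nonempty. -/
class NoSources : Prop where
  nonempty : ∀ (v : Λ.Vertex) (n : Fin k → ℕ), (Λ.pathsInto v n).Nonempty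

/-! ### Infinite paths and cofinality -/

/-- An infinite path `x`: a degree-preserving functor from `Ω_k` to `Λ`. The category `Ω_k` has
object set `ℕ^k`, and exactly one morphism `(p, q)`, with source `q`, range `p` and degree `q - p`,
for each pair `p ≤ q`. The image of the object `n` is `x(n)`, and that of `(p, q)` is `x(p, q)`. -/
structure InfinitePath where
  vertex : (Fin k → ℕ) → Λ.Vertex
  map : ∀ {p q : Fin k → ℕ}, p ≤ q → (vertex q ⟶ vertex p)
  map_id : ∀ p : Fin k → ℕ, map (le_refl p) = 𝟙 (vertex p)
  map_comp : ∀ {p q r : Fin k → ℕ} (hpq : p ≤ q) (hqr : q ≤ r),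
    map (hpq.trans hqr) = map hqr ≫ map hpq
  degree_map : ∀ {p q : Fin k → ℕ} (h : p ≤ q), Λ.degree (map h) = q - p

/-- `Λ` is cofinal if for every infinite path `x` and every vertex `v` there is `n` such that
`vΛx(n)`, the set of paths from `x(n)` to `v`, is nonempty. -/
def IsCofinal : Prop :=
  ∀ (y : Λ.InfinitePath) (v : Λ.Vertex), ∃ n : Fin k → ℕ, Nonempty (y.vertex n ⟶ v)

/-! ### Segments of finite paths and aperiodicity -/

variable {Λ} in
/-- `g` is the middle factor of a factorization of `f` with factors of degrees
`p`, `q - p` and `d(f) - q`. -/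
def Path.IsSegment (f : Λ.Path) (p q : Fin k → ℕ) (g : Λ.Path) : Prop :=
  ∃ (a : g.rng ⟶ f.rng) (c : f.src ⟶ g.src),
    Λ.degree a = p ∧ g.deg = q - p ∧ Λ.degree c = f.deg - q ∧ c ≫ g.hom ≫ a = f.hom

variable {Λ} in
theorem Path.existsUnique_isSegment (f : Λ.Path) {p q : Fin k → ℕ} (hpq : p ≤ q)
    (hq : q ≤ f.deg) : ∃! g : Λ.Path, f.IsSegment p q g := by
  obtain ⟨v, t, f⟩ := f
  change q ≤ Λ.degree f at hq
  have h1 : Λ.degree f = p + (Λ.degree f - p) := (add_tsub_cancel_of_le (hpq.trans hq)).symm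
  obtain ⟨⟨t₁, b, a⟩, ⟨ha, hb, hab⟩, huniq⟩ := Λ.factorization f p _ h1
  dsimp only at ha hb hab
  have h2 : Λ.degree b = (q - p) + (Λ.degree f - q) := by
    rw [hb, add_comm, tsub_add_tsub_cancel hq hpq]
  obtain ⟨⟨t₂, c, g⟩, ⟨hg, hc, hcg⟩, huniq'⟩ := Λ.factorization b _ _ h2
  dsimp only at hg hc hcg
  refine ⟨⟨t₂, t₁, g⟩, ⟨a, c, ha, hg, hc, ?_⟩, ?_⟩
  · change c ≫ g ≫ a = f
    rw [← Category.assoc, hcg, hab]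
  · rintro ⟨s₂, s₁, g'⟩ ⟨a', c', ha', hg', hc', hf'⟩
    change Λ.degree g' = _ at hg'
    change s₁ ⟶ t at a'
    change v ⟶ s₂ at c'
    change c' ≫ g' ≫ a' = f at hf'
    change Λ.degree c' = Λ.degree f - q at hc'
    have e1 := huniq ⟨s₁, c' ≫ g', a'⟩ ⟨ha', by
      change Λ.degree (c' ≫ g') = _
      rw [Λ.degree_comp, hg', hc', add_comm, tsub_add_tsub_cancel hq hpq], by
      change (c' ≫ g') ≫ a' = f
      rw [Category.assoc, hf']⟩
    obtain rfl : s₁ = t₁ := congrArg Sigma.fst e1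
    have e1' := eq_of_heq (Sigma.mk.inj e1).2
    have eb : c' ≫ g' = b := congrArg Prod.fst e1'
    have e2 := huniq' ⟨s₂, c', g'⟩ ⟨hg', hc', eb⟩
    obtain rfl : s₂ = t₂ := congrArg Sigma.fst e2
    have e2' := eq_of_heq (Sigma.mk.inj e2).2
    have eg : g' = g := congrArg Prod.snd e2'
    rw [eg]

variable {Λ} in
/-- The segment `f(p, q)` of a path `f`, for `p ≤ q ≤ d(f)`: the unique path `g` with
`f = f'gf''`, `d(f') = p`, `d(g) = q - p` and `d(f'') = d(f) - q`. -/
noncomputable def Path.segment (f : Λ.Path) (p q : Fin k → ℕ) (hpq : p ≤ q)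
    (hq : q ≤ f.deg) : Λ.Path :=
  (f.existsUnique_isSegment hpq hq).choose

theorem add_tsub_sup_le {m n d : Fin k → ℕ} (h : m ⊔ n ≤ d) :
    m + (d - m ⊔ n) ≤ d ∧ n + (d - m ⊔ n) ≤ d :=
  ⟨(add_le_add_left le_sup_left _).trans (add_tsub_cancel_of_le h).le,
    (add_le_add_left le_sup_right _).trans (add_tsub_cancel_of_le h).le⟩

/-- `Λ` is aperiodic if for every vertex `v` and all `m ≠ n` in `ℕ^k` there is a path `f` with
range `v` and `d(f) ≥ m ∨ n` such that
`f(m, m + d(f) - (m ∨ n)) ≠ f(n, n + d(f) - (m ∨ n))`. -/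
def IsAperiodic : Prop :=
  ∀ (v : Λ.Vertex) (m n : Fin k → ℕ), m ≠ n →
    ∃ (f : Λ.Path) (_ : f.rng = v) (h : m ⊔ n ≤ f.deg),
      f.segment m (m + (f.deg - m ⊔ n)) le_self_add (add_tsub_sup_le h).1 ≠
        f.segment n (n + (f.deg - m ⊔ n)) le_self_add (add_tsub_sup_le h).2

/-! ### The Kumjian-Pask algebra -/

/-- The generating set `Λ⁰ ∪ Λ^{≠0} ∪ G(Λ^{≠0})`: vertices, paths of nonzero degree, and a ghost
path for each path of nonzero degree. -/
inductive Generator : Type (max u w)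
  | vertex (v : Λ.Vertex) : Generator
  | path (f : Λ.Path) (hf : f.deg ≠ 0) : Generator
  | ghost (f : Λ.Path) (hf : f.deg ≠ 0) : Generator

variable (R : Type x) [CommRing R]

/-- The free (associative, not necessarily unital) `R`-algebra on the generators: its
elements are the `R`-linear combinations of nonempty words. -/
abbrev FreeAlg : Type (max u w x) := MonoidAlgebra R (FreeSemigroup Λ.Generator)

namespace FreeAlg

variable {Λ}

/-- The vertex `v` as an element of the free algebra. -/
noncomputable def vertex (v : Λ.Vertex) : Λ.FreeAlg R :=
  MonoidAlgebra.single (FreeSemigroup.of (Generator.vertex v)) 1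

/-- The path `f` as an element of the free algebra; a path of degree `0` is the identity morphism
at a vertex, and is identified with that vertex. -/
noncomputable def path (f : Λ.Path) : Λ.FreeAlg R :=
  if hf : f.deg = 0 then vertex R f.src
  else MonoidAlgebra.single (FreeSemigroup.of (Generator.path f hf)) 1

/-- The ghost path `f*` as an element of the free algebra, where `v* = v` for a vertex `v`. -/
noncomputable def ghost (f : Λ.Path) : Λ.FreeAlg R :=
  if hf : f.deg = 0 then vertex R f.src
  else MonoidAlgebra.single (FreeSemigroup.of (Generator.ghost f hf)) 1

end FreeAlg

open FreeAlg in
/-- The relators `a - b`, one for each of the Kumjian-Pask relations `a = b`: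
* the vertices are mutually orthogonal idempotents;
* `λ μ = λμ` and `μ* λ* = (λμ)*` if `r(μ) = s(λ)`, `r(λ) λ = λ = λ s(λ)` and
  `s(λ) λ* = λ* = λ* r(λ)`, for `λ, μ` of nonzero degree;
* `λ* μ = δ_{λ,μ} s(λ)` for `λ, μ` of equal nonzero degree;
* `v = ∑_{λ ∈ vΛⁿ} λ λ*` for all vertices `v` and `n ≠ 0`. -/
inductive IsRelator [Λ.RowFinite] : Λ.FreeAlg R → Prop
  | vertex_mul_self (v : Λ.Vertex) : IsRelator (vertex R v * vertex R v - vertex R v)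
  | vertex_mul_vertex (v w : Λ.Vertex) (h : v ≠ w) : IsRelator (vertex R v * vertex R w - 0)
  | path_mul_path {t u v : Λ.Vertex} (μ : t ⟶ u) (ν : u ⟶ v)
      (hμ : Λ.degree μ ≠ 0) (hν : Λ.degree ν ≠ 0) :
      IsRelator (path R ⟨u, v, ν⟩ * path R ⟨t, u, μ⟩ - path R ⟨t, v, μ ≫ ν⟩)
  | ghost_mul_ghost {t u v : Λ.Vertex} (μ : t ⟶ u) (ν : u ⟶ v)
      (hμ : Λ.degree μ ≠ 0) (hν : Λ.degree ν ≠ 0) :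
      IsRelator (ghost R ⟨t, u, μ⟩ * ghost R ⟨u, v, ν⟩ - ghost R ⟨t, v, μ ≫ ν⟩)
  | rng_mul_path (f : Λ.Path) (hf : f.deg ≠ 0) :
      IsRelator (vertex R f.rng * path R f - path R f)
  | path_mul_src (f : Λ.Path) (hf : f.deg ≠ 0) :
      IsRelator (path R f * vertex R f.src - path R f)
  | src_mul_ghost (f : Λ.Path) (hf : f.deg ≠ 0) :
      IsRelator (vertex R f.src * ghost R f - ghost R f)
  | ghost_mul_rng (f : Λ.Path) (hf : f.deg ≠ 0) :
      IsRelator (ghost R f * vertex R f.rng - ghost R f)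
  | ghost_mul_path_self (f : Λ.Path) (hf : f.deg ≠ 0) :
      IsRelator (ghost R f * path R f - vertex R f.src)
  | ghost_mul_path_ne (f g : Λ.Path) (hf : f.deg ≠ 0) (hd : f.deg = g.deg) (hne : f ≠ g) :
      IsRelator (ghost R f * path R g - 0)
  | vertex_eq_sum (v : Λ.Vertex) (n : Fin k → ℕ) (hn : n ≠ 0) :
      IsRelator (vertex R v -
        ∑ f ∈ (RowFinite.finite (Λ := Λ) v n).toFinset, path R f * ghost R f)

/-- The ideal of the `R`-algebra `FreeAlg` generated by the relators: since `FreeAlg` has no unit,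
the scalar multiples of the relators are put in explicitly, which makes it an `R`-submodule. -/
noncomputable def relIdeal [Λ.RowFinite] : TwoSidedIdeal (Λ.FreeAlg R) :=
  TwoSidedIdeal.span {a | ∃ (r : R) (b : Λ.FreeAlg R), Λ.IsRelator R b ∧ a = r • b}

theorem smul_mem_relIdeal [Λ.RowFinite] (r : R) {a : Λ.FreeAlg R} (ha : a ∈ Λ.relIdeal R) :
    r • a ∈ Λ.relIdeal R := by
  unfold relIdeal at ha ⊢
  induction ha using TwoSidedIdeal.span_induction with
  | mem x hx =>
    obtain ⟨t, b, hb, rfl⟩ := hx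
    exact TwoSidedIdeal.subset_span ⟨r * t, b, hb, (mul_smul r t b).symm⟩
  | zero => rw [smul_zero]; exact TwoSidedIdeal.zero_mem _
  | add x y _ _ hx hy => rw [smul_add]; exact TwoSidedIdeal.add_mem _ hx hy
  | neg x _ hx => rw [smul_neg]; exact TwoSidedIdeal.neg_mem _ hx
  | left_absorb a x _ hx => rw [← mul_smul_comm]; exact TwoSidedIdeal.mul_mem_left _ _ _ hx
  | right_absorb b x _ hx => rw [← smul_mul_assoc]; exact TwoSidedIdeal.mul_mem_right _ _ _ hx

/-- The Kumjian-Pask algebra `KP_R(Λ)`: the quotient of the free `R`-algebra on the generators by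
the ideal generated by the Kumjian-Pask relators. -/
def KumjianPask [Λ.RowFinite] : Type (max u w x) := (Λ.relIdeal R).ringCon.Quotient

namespace KumjianPask

variable [Λ.RowFinite]

noncomputable instance : NonUnitalRing (Λ.KumjianPask R) :=
  inferInstanceAs (NonUnitalRing (Λ.relIdeal R).ringCon.Quotient)

/-- The quotient map. -/
noncomputable def mk : Λ.FreeAlg R → Λ.KumjianPask R := fun a => (a : (Λ.relIdeal R).ringCon.Quotient)

noncomputable instance : SMul R (Λ.KumjianPask R) where
  smul r := Quotient.map' (r • ·) fun a b (h : (Λ.relIdeal R).ringCon a b) => by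
    change (Λ.relIdeal R).ringCon (r • a) (r • b)
    rw [TwoSidedIdeal.rel_iff] at h ⊢
    rw [← smul_sub]
    exact Λ.smul_mem_relIdeal R r h

noncomputable instance : Module R (Λ.KumjianPask R) where
  one_smul := Quotient.ind' fun a => congrArg (mk Λ R) (one_smul R a)
  mul_smul r t := Quotient.ind' fun a => congrArg (mk Λ R) (mul_smul r t a)
  smul_zero r := congrArg (mk Λ R) (smul_zero r)
  smul_add r := Quotient.ind₂' fun a b => congrArg (mk Λ R) (smul_add r a b)
  add_smul r t := Quotient.ind' fun a => congrArg (mk Λ R) (add_smul r t a)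
  zero_smul := Quotient.ind' fun a => congrArg (mk Λ R) (zero_smul R a)

instance : IsScalarTower R (Λ.KumjianPask R) (Λ.KumjianPask R) where
  smul_assoc r := Quotient.ind₂' fun a b => congrArg (mk Λ R) (smul_mul_assoc r a b)

instance : SMulCommClass R (Λ.KumjianPask R) (Λ.KumjianPask R) where
  smul_comm r := Quotient.ind₂' fun a b => congrArg (mk Λ R) (mul_smul_comm r a b).symm

variable {Λ} in
/-- The vertex idempotent `p_v`. -/
noncomputable def p (v : Λ.Vertex) : Λ.KumjianPask R := mk Λ R (FreeAlg.vertex R v)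

variable {Λ R} in
/-- An ideal `I` of `KP_R(Λ)` is basic if `r p_v ∈ I` with `r ≠ 0` implies `p_v ∈ I`. -/
def IsBasic (I : TwoSidedIdeal (Λ.KumjianPask R)) : Prop :=
  ∀ (v : Λ.Vertex) (r : R), r ≠ 0 → r • p R v ∈ I → p R v ∈ I

/-- `KP_R(Λ)` is basically simple if its only basic ideals are `{0}` and `KP_R(Λ)`. -/
def IsBasicallySimple : Prop :=
  ∀ I : TwoSidedIdeal (Λ.KumjianPask R), IsBasic I → I = ⊥ ∨ I = ⊤

end KumjianPask

end KGraph

-- Necessity rests on representations. Paths act on infinite paths by prepending, and any set with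
-- such an action (`PathSpace`) gives a representation on functions: `s_f` extends by zero along
-- `f`, and `s_{f*}` restricts along `f`. There `r p_v` acts as zero only if `r = 0` or no point
-- lies over `v`, so every kernel is a basic ideal (`isBasic_ker`), and basic simplicity makes it
-- zero or everything. Cofinality: use the infinite paths none of whose vertices is the source of a
-- path to `v`. The kernel contains `p_v ≠ 0`, hence is everything, so no such infinite path exists.
-- Aperiodicity: if it fails, some `f`, `g` of different degrees satisfy `fy = gy` for all infinite
-- paths `y` (`exists_cons_eq_cons_of_not_isAperiodic`). The representation on all infinite paths
-- kills `s_f - s_g` but no `p_v`, so basic simplicity forces `s_f = s_g`; a copy of this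
-- representation graded by `ℤ^k` refutes that (`path_ne_path`).
--
-- Sufficiency: a nonzero `a` in a basic ideal, multiplied by a suitable long path, becomes a
-- nonzero combination of real paths. Aperiodicity isolates one term, so some `r p_v` with `r ≠ 0`
-- lies in the ideal (`exists_mul_mul_eq_smul_p`). Basicness gives `p_v`, cofinality spreads
-- membership to every vertex (`forall_p_mem_of_isCofinal`), and finite sums of vertices are local
-- units.

universe z

namespace KGraph

/-! ### Unique factorization and initial segments -/

section Factorization

variable {k : ℕ} {Λ : KGraph.{u, w} k}

theorem factor_unique {t u₁ u₂ v : Λ.Vertex} {h₁ : t ⟶ u₁} {f₁ : u₁ ⟶ v} {h₂ : t ⟶ u₂}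
    {f₂ : u₂ ⟶ v} (h : h₁ ≫ f₁ = h₂ ≫ f₂) (hd : Λ.degree f₁ = Λ.degree f₂) :
    (⟨u₁, h₁, f₁⟩ : Σ u : Λ.Vertex, (t ⟶ u) × (u ⟶ v)) = ⟨u₂, h₂, f₂⟩ := by
  have hd' : Λ.degree h₁ = Λ.degree h₂ := by
    have := congrArg Λ.degree h
    rw [Λ.degree_comp, Λ.degree_comp, hd] at this
    exact add_left_cancel this
  exact (Λ.factorization (h₁ ≫ f₁) (Λ.degree f₁) (Λ.degree h₁) (Λ.degree_comp _ _)).unique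
    ⟨rfl, rfl, rfl⟩ ⟨hd.symm, hd'.symm, h.symm⟩

theorem exists_factor {v t : Λ.Vertex} (f : t ⟶ v) {n : Fin k → ℕ} (hn : n ≤ Λ.degree f) :
    ∃ (u : Λ.Vertex) (h : t ⟶ u) (g : u ⟶ v), Λ.degree g = n ∧ h ≫ g = f := by
  obtain ⟨⟨u, h, g⟩, ⟨hg, -, e⟩, -⟩ :=
    Λ.factorization f n (Λ.degree f - n) (add_tsub_cancel_of_le hn).symm
  exact ⟨u, h, g, hg, e⟩

theorem comp_right_cancel {t u v : Λ.Vertex} {h₁ h₂ : t ⟶ u} {f : u ⟶ v}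
    (h : h₁ ≫ f = h₂ ≫ f) : h₁ = h₂ := by
  have := factor_unique h rfl
  simpa using this

theorem Path.exists_eq_id {f : Λ.Path} (hf : f.deg = 0) : ∃ v, f = ⟨v, v, 𝟙 v⟩ := by
  obtain ⟨s, t, f⟩ := f
  have h : f ≫ 𝟙 t = 𝟙 s ≫ f := by simp
  have := factor_unique h (by rw [Λ.degree_id]; exact hf.symm)
  obtain rfl : t = s := congrArg Sigma.fst this
  have e : f = 𝟙 t := congrArg Prod.fst (eq_of_heq (Sigma.mk.inj this).2)
  exact ⟨t, by rw [e]⟩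

variable (Λ) in
/-- The paths with range `v`. -/
abbrev Into (v : Λ.Vertex) := Σ u : Λ.Vertex, (u ⟶ v)

/-- `a` is an initial segment of `b`. -/
def IsPrefix {v : Λ.Vertex} (a b : Λ.Into v) : Prop := ∃ h : b.1 ⟶ a.1, h ≫ a.2 = b.2

namespace IsPrefix

variable {v : Λ.Vertex} {a b c : Λ.Into v}

theorem refl (a : Λ.Into v) : IsPrefix a a := ⟨𝟙 _, Category.id_comp _⟩

theorem trans (hab : IsPrefix a b) (hbc : IsPrefix b c) : IsPrefix a c := by
  obtain ⟨h, e⟩ := hab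
  obtain ⟨g, e'⟩ := hbc
  exact ⟨g ≫ h, by rw [Category.assoc, e, e']⟩

theorem eq_of_degree_eq (hac : IsPrefix a c) (hbc : IsPrefix b c)
    (hd : Λ.degree a.2 = Λ.degree b.2) : a = b := by
  obtain ⟨u₁, a⟩ := a
  obtain ⟨u₂, b⟩ := b
  obtain ⟨h, e⟩ := hac
  obtain ⟨g, e'⟩ := hbc
  have := factor_unique (e.trans e'.symm) hd
  obtain rfl : u₁ = u₂ := congrArg Sigma.fst this
  rw [show a = b from congrArg Prod.snd (eq_of_heq (Sigma.mk.inj this).2)]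

/-- Cut `b` down to the degree of `a`: the result and `a` are initial segments of `c` of equal
degree, so they coincide. -/
theorem of_degree_le (hac : IsPrefix a c) (hbc : IsPrefix b c)
    (hd : Λ.degree a.2 ≤ Λ.degree b.2) : IsPrefix a b := by
  obtain ⟨t, h, g, hg, e⟩ := exists_factor b.2 hd
  have hb : IsPrefix ⟨t, g⟩ b := ⟨h, e⟩
  rw [hac.eq_of_degree_eq (hb.trans hbc) hg.symm]
  exact hb

theorem comp {u : Λ.Vertex} {a b : Λ.Into u} (hab : IsPrefix a b) (f : u ⟶ v) :
    IsPrefix (⟨a.1, a.2 ≫ f⟩ : Λ.Into v) ⟨b.1, b.2 ≫ f⟩ := by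
  obtain ⟨h, e⟩ := hab
  exact ⟨h, by rw [← e, Category.assoc]⟩

theorem of_comp {u : Λ.Vertex} {a b : Λ.Into u} {f : u ⟶ v}
    (h : IsPrefix (⟨a.1, a.2 ≫ f⟩ : Λ.Into v) ⟨b.1, b.2 ≫ f⟩) : IsPrefix a b := by
  obtain ⟨h, e⟩ := h
  exact ⟨h, comp_right_cancel (f := f) (by simpa using e)⟩

end IsPrefix

theorem exists_isPrefix {v : Λ.Vertex} (a : Λ.Into v) {n : Fin k → ℕ} (hn : n ≤ Λ.degree a.2) :
    ∃ b : Λ.Into v, Λ.degree b.2 = n ∧ IsPrefix b a := by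
  obtain ⟨u, h, g, hg, e⟩ := exists_factor a.2 hn
  exact ⟨⟨u, g⟩, hg, h, e⟩

/-! ### Infinite paths, prepending and tails -/

variable (Λ) in
/-- An infinite path with range `v`, recorded by its initial segments. -/
@[ext]
structure Ray (v : Λ.Vertex) where
  init : (Fin k → ℕ) → Λ.Into v
  degree_init : ∀ n, Λ.degree (init n).2 = n
  isPrefix : ∀ {m n}, m ≤ n → IsPrefix (init m) (init n)

namespace Ray

variable {v : Λ.Vertex}

theorem eq_of_forall {y z : Λ.Ray v}
    (h : ∀ n, ∃ a, IsPrefix (y.init n) a ∧ IsPrefix (z.init n) a) : y = z := by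
  ext1
  funext n
  obtain ⟨a, h₁, h₂⟩ := h n
  exact h₁.eq_of_degree_eq h₂ (by rw [y.degree_init, z.degree_init])

/-- The ray whose initial segments are initial segments of the given family of paths. -/
theorem exists_ray (c : (Fin k → ℕ) → Λ.Into v) (hd : ∀ n, n ≤ Λ.degree (c n).2)
    (hc : ∀ {m n}, m ≤ n → IsPrefix (c m) (c n)) :
    ∃ y : Λ.Ray v, ∀ n, IsPrefix (y.init n) (c n) := by
  choose b hb hbc using fun n => exists_isPrefix (c n) (hd n)
  exact ⟨⟨b, hb, fun {m n} hmn => ((hbc m).trans (hc hmn)).of_degree_le (hbc n)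
    (by rw [hb, hb]; exact hmn)⟩, hbc⟩

theorem exists_cons {u : Λ.Vertex} (f : u ⟶ v) (y : Λ.Ray u) :
    ∃ z : Λ.Ray v, ∀ n, IsPrefix (z.init n) ⟨(y.init n).1, (y.init n).2 ≫ f⟩ :=
  exists_ray (fun n => ⟨(y.init n).1, (y.init n).2 ≫ f⟩)
    (fun n => by rw [Λ.degree_comp, y.degree_init]; exact le_add_self)
    (fun h => (y.isPrefix h).comp f)

/-- The infinite path `fy`. -/
noncomputable def cons {u : Λ.Vertex} (f : u ⟶ v) (y : Λ.Ray u) : Λ.Ray v :=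
  (exists_cons f y).choose

theorem cons_isPrefix {u : Λ.Vertex} (f : u ⟶ v) (y : Λ.Ray u) {m n : Fin k → ℕ} (h : m ≤ n) :
    IsPrefix ((cons f y).init m) ⟨(y.init n).1, (y.init n).2 ≫ f⟩ :=
  ((exists_cons f y).choose_spec m).trans ((y.isPrefix h).comp f)

theorem init_cons_add {u : Λ.Vertex} (f : u ⟶ v) (y : Λ.Ray u) (n : Fin k → ℕ) :
    (cons f y).init (n + Λ.degree f) = ⟨(y.init n).1, (y.init n).2 ≫ f⟩ := by
  refine (cons_isPrefix f y le_rfl).eq_of_degree_eq ((y.isPrefix le_self_add).comp f) ?_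
  rw [degree_init, Λ.degree_comp, degree_init, add_comm]

theorem init_cons_degree {u : Λ.Vertex} (f : u ⟶ v) (y : Λ.Ray u) :
    (cons f y).init (Λ.degree f) = ⟨u, f⟩ := by
  have h : IsPrefix (⟨u, f⟩ : Λ.Into v)
      ⟨(y.init (Λ.degree f)).1, (y.init (Λ.degree f)).2 ≫ f⟩ := ⟨_, rfl⟩
  exact (cons_isPrefix f y le_rfl).eq_of_degree_eq h (degree_init _ _)

theorem cons_comp {t u : Λ.Vertex} (g : t ⟶ u) (f : u ⟶ v) (y : Λ.Ray t) :
    cons (g ≫ f) y = cons f (cons g y) :=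
  eq_of_forall fun n => ⟨_, cons_isPrefix (g ≫ f) y le_rfl, by
    refine (cons_isPrefix f (cons g y) le_rfl).trans ?_
    rw [← Category.assoc]
    exact (cons_isPrefix g y (le_refl n)).comp f⟩

theorem cons_injective {u : Λ.Vertex} (f : u ⟶ v) : Function.Injective (cons (Λ := Λ) f) := by
  intro y z h
  refine eq_of_forall fun n => ⟨z.init n, IsPrefix.of_comp (f := f) ?_, .refl _⟩
  rw [← init_cons_add f y n, ← init_cons_add f z n, h]
  exact .refl _

theorem exists_eq_cons (y : Λ.Ray v) (n : Fin k → ℕ) :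
    ∃ z : Λ.Ray (y.init n).1, cons (y.init n).2 z = y := by
  -- `h m` is the piece of `y` between `n` and `m + n`; these pieces are the initial segments of the
  -- tail.
  choose h hh using fun m : Fin k → ℕ => y.isPrefix (le_add_self : n ≤ m + n)
  have hc : ∀ {m m'}, m ≤ m' → IsPrefix (⟨_, h m⟩ : Λ.Into (y.init n).1) ⟨_, h m'⟩ := by
    intro m m' hm
    refine IsPrefix.of_comp (f := (y.init n).2) ?_
    rw [hh m, hh m']
    exact y.isPrefix (add_le_add_left hm n)
  have hdeg : ∀ m, m ≤ Λ.degree (h m) := fun m => by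
    have := congrArg Λ.degree (hh m)
    rw [Λ.degree_comp, degree_init, degree_init, add_comm] at this
    exact (add_right_cancel this).ge
  obtain ⟨z, hz⟩ := exists_ray (fun m => ⟨_, h m⟩) hdeg hc
  refine ⟨z, eq_of_forall fun m => ⟨y.init (m + n), ?_, y.isPrefix le_self_add⟩⟩
  refine (cons_isPrefix _ z (le_refl m)).trans ?_
  have := (hz m).comp (y.init n).2
  rwa [hh m] at this

/-- The infinite path, as a functor on `Ω_k`, with the given initial segments. -/
noncomputable def toInfinitePath (y : Λ.Ray v) : Λ.InfinitePath where
  vertex n := (y.init n).1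
  map h := (y.isPrefix h).choose
  map_id p := comp_right_cancel (f := (y.init p).2) (by
    rw [(y.isPrefix le_rfl).choose_spec, Category.id_comp])
  map_comp {p q r} hpq hqr := comp_right_cancel (f := (y.init p).2) (by
    rw [Category.assoc, (y.isPrefix hpq).choose_spec, (y.isPrefix hqr).choose_spec,
      (y.isPrefix (hpq.trans hqr)).choose_spec])
  degree_map {p q} h := by
    have := congrArg Λ.degree (y.isPrefix h).choose_spec
    rw [Λ.degree_comp, degree_init, degree_init] at this
    exact eq_tsub_of_add_eq (by rw [add_comm]; exact this)

/-- The family of initial segments of an infinite path. -/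
def ofInfinitePath (y : Λ.InfinitePath) : Λ.Ray (y.vertex 0) where
  init n := ⟨y.vertex n, y.map bot_le⟩
  degree_init n := by rw [y.degree_map, tsub_zero]
  isPrefix {m n} h := ⟨y.map h, (y.map_comp bot_le h).symm⟩

/-- Steps of degree `(1, …, 1)` give partial paths `c N` with every coordinate of the degree at
least `N`, which determine an infinite path. Only the endpoints of the `c N` are known to satisfy
`Q`; a general `y(n)` is merely reached from such an endpoint. -/
theorem exists_of_forall_exists (Q : Λ.Vertex → Prop)
    (hQ : ∀ v, Q v → ∃ (u : Λ.Vertex) (f : u ⟶ v), Λ.degree f = 1 ∧ Q u) (hv : Q v) :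
    ∃ y : Λ.Ray v, ∀ n, ∃ u, Q u ∧ Nonempty (u ⟶ (y.init n).1) := by
  choose! s f hf hs using hQ
  let c : ℕ → {a : Λ.Into v // Q a.1} := fun N =>
    N.rec ⟨⟨v, 𝟙 v⟩, hv⟩ fun _ a => ⟨⟨s a.1.1, f a.1.1 a.2 ≫ a.1.2⟩, hs _ a.2⟩
  have hc1 : ∀ N, (c (N + 1)).1 = ⟨s (c N).1.1, f (c N).1.1 (c N).2 ≫ (c N).1.2⟩ := fun N => rfl
  have hdeg : ∀ (N : ℕ) (i : Fin k), N ≤ Λ.degree (c N).1.2 i := by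
    intro N i
    induction N with
    | zero => exact Nat.zero_le _
    | succ N ih =>
      rw [hc1]
      dsimp only
      rw [Λ.degree_comp, hf, Pi.add_apply, Pi.one_apply]
      exact Nat.succ_le_succ ih
  have hmono : ∀ {M N}, M ≤ N → IsPrefix (c M).1 (c N).1 := by
    intro M N h
    induction h with
    | refl => exact .refl _
    | step _ ih => exact ih.trans ⟨f _ _, rfl⟩
  -- The largest coordinate of `n` is a number of steps sufficient to cover degree `n`.
  obtain ⟨y, hy⟩ := exists_ray (fun n => (c (Finset.univ.sup n)).1)
    (fun n i => (Finset.le_sup (Finset.mem_univ i)).trans (hdeg _ i))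
    (fun {m n} h => hmono (Finset.sup_mono_fun fun i _ => h i))
  refine ⟨y, fun n => ⟨_, (c (Finset.univ.sup n)).2, ?_⟩⟩
  obtain ⟨h, -⟩ := hy n
  exact ⟨h⟩

theorem nonempty [Λ.NoSources] (v : Λ.Vertex) : Nonempty (Λ.Ray v) := by
  obtain ⟨y, -⟩ := exists_of_forall_exists (v := v) (fun _ => True) (fun v _ => by
    obtain ⟨⟨s, t, f⟩, rfl, hd⟩ := NoSources.nonempty (Λ := Λ) v 1
    exact ⟨s, f, hd, trivial⟩) trivial
  exact ⟨y⟩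

end Ray

end Factorization

/-! ### Representations on functions over a path space -/

section Representation

variable {k : ℕ}

/-- Sets on which the paths of a `k`-graph act by injections, such that for each degree `n` every
point is `fz` for a unique path `f` of degree `n` and a unique point `z`. -/
structure PathSpace (Λ : KGraph.{u, w} k) where
  pt : Λ.Vertex → Type z
  act : ∀ {u v : Λ.Vertex}, (u ⟶ v) → pt u → pt v
  act_comp : ∀ {t u v : Λ.Vertex} (g : t ⟶ u) (f : u ⟶ v) (y : pt t),
    act (g ≫ f) y = act f (act g y)
  act_injective : ∀ {u v : Λ.Vertex} (f : u ⟶ v), Function.Injective (act f)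
  exists_act : ∀ {v : Λ.Vertex} (y : pt v) (n : Fin k → ℕ),
    ∃ (u : Λ.Vertex) (f : u ⟶ v) (z : pt u), Λ.degree f = n ∧ act f z = y
  act_eq : ∀ {t u v : Λ.Vertex} {f : t ⟶ v} {g : u ⟶ v} {y : pt t} {z : pt u},
    act f y = act g z → Λ.degree f = Λ.degree g → (⟨t, f⟩ : Λ.Into v) = ⟨u, g⟩

namespace PathSpace

variable {Λ : KGraph.{u, w} k} (F : PathSpace.{u, w, z} Λ) (R : Type x) [CommRing R]

theorem act_id {v : Λ.Vertex} (y : F.pt v) : F.act (𝟙 v) y = y :=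
  F.act_injective (𝟙 v) (by rw [← F.act_comp, Category.id_comp])

/-- The functions on all points of a path space. -/
abbrev Fun := (v : Λ.Vertex) → F.pt v → R

open Classical in
/-- The endomorphism of `Fun` with a single nonzero block `T`. -/
noncomputable def block {u v : Λ.Vertex} (T : (F.pt u → R) →ₗ[R] (F.pt v → R)) :
    Module.End R (F.Fun R) :=
  LinearMap.single R (fun v => F.pt v → R) v ∘ₗ T ∘ₗ LinearMap.proj u

variable {R}

theorem block_apply_self {u v : Λ.Vertex} (T : (F.pt u → R) →ₗ[R] (F.pt v → R)) (φ : F.Fun R) :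
    F.block R T φ v = T (φ u) := by
  simp [block]

theorem block_apply_of_ne {u v t : Λ.Vertex} (h : t ≠ v) (T : (F.pt u → R) →ₗ[R] (F.pt v → R))
    (φ : F.Fun R) : F.block R T φ t = 0 := by
  simp [block, h]

theorem block_mul_block {t u v : Λ.Vertex} (T : (F.pt u → R) →ₗ[R] (F.pt v → R))
    (T' : (F.pt t → R) →ₗ[R] (F.pt u → R)) :
    F.block R T * F.block R T' = F.block R (T ∘ₗ T') := by
  ext φ
  simp [block]

theorem block_mul_block_of_ne {t u u' v : Λ.Vertex} (h : u ≠ u')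
    (T : (F.pt u → R) →ₗ[R] (F.pt v → R)) (T' : (F.pt t → R) →ₗ[R] (F.pt u' → R)) :
    F.block R T * F.block R T' = 0 := by
  refine LinearMap.ext fun φ => ?_
  simp [block, h]

variable (R)

/-- The identity of the functions on the points over `v`. -/
abbrev idMap (v : Λ.Vertex) : (F.pt v → R) →ₗ[R] (F.pt v → R) := LinearMap.id

/-- Extension by zero along the action of a path. -/
noncomputable def extend {u v : Λ.Vertex} (f : u ⟶ v) : (F.pt u → R) →ₗ[R] (F.pt v → R) :=
  Function.ExtendByZero.linearMap R (F.act f)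

/-- Restriction along the action of a path. -/
def restrict {u v : Λ.Vertex} (f : u ⟶ v) : (F.pt v → R) →ₗ[R] (F.pt u → R) :=
  LinearMap.funLeft R R (F.act f)

variable {R}

theorem extend_act {u v : Λ.Vertex} (f : u ⟶ v) (φ : F.pt u → R) (y : F.pt u) :
    F.extend R f φ (F.act f y) = φ y :=
  (F.act_injective f).extend_apply φ (0 : F.pt v → R) y

theorem extend_of_not_exists {u v : Λ.Vertex} (f : u ⟶ v) (φ : F.pt u → R) {y : F.pt v}
    (h : ¬ ∃ z, F.act f z = y) : F.extend R f φ y = 0 :=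
  Function.extend_apply' φ (0 : F.pt v → R) y h

theorem restrict_apply {u v : Λ.Vertex} (f : u ⟶ v) (φ : F.pt v → R) (y : F.pt u) :
    F.restrict R f φ y = φ (F.act f y) := rfl

theorem extend_id (v : Λ.Vertex) : F.extend R (𝟙 v) = F.idMap R v := by
  refine LinearMap.ext fun φ => funext fun y => ?_
  conv_lhs => rw [← F.act_id y]
  exact F.extend_act _ _ _

theorem restrict_id (v : Λ.Vertex) : F.restrict R (𝟙 v) = F.idMap R v := by
  refine LinearMap.ext fun φ => funext fun y => ?_
  rw [restrict_apply, F.act_id, LinearMap.id_apply]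

theorem extend_comp {t u v : Λ.Vertex} (g : t ⟶ u) (f : u ⟶ v) :
    F.extend R (g ≫ f) = F.extend R f ∘ₗ F.extend R g := by
  refine LinearMap.ext fun φ => funext fun y => ?_
  rw [LinearMap.comp_apply]
  by_cases h : ∃ z, F.act f z = y
  · obtain ⟨z, rfl⟩ := h
    rw [extend_act]
    by_cases h : ∃ a, F.act g a = z
    · obtain ⟨a, rfl⟩ := h
      rw [extend_act, ← F.act_comp, extend_act]
    · rw [F.extend_of_not_exists g φ h, extend_of_not_exists]
      rintro ⟨a, ha⟩
      rw [F.act_comp] at ha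
      exact h ⟨a, F.act_injective f ha⟩
  · rw [F.extend_of_not_exists f _ h, extend_of_not_exists]
    rintro ⟨a, ha⟩
    exact h ⟨F.act g a, by rw [← F.act_comp, ha]⟩

theorem restrict_comp {t u v : Λ.Vertex} (g : t ⟶ u) (f : u ⟶ v) :
    F.restrict R (g ≫ f) = F.restrict R g ∘ₗ F.restrict R f := by
  refine LinearMap.ext fun φ => funext fun y => ?_
  rw [LinearMap.comp_apply, restrict_apply, restrict_apply, restrict_apply, F.act_comp]

theorem restrict_comp_extend {u v : Λ.Vertex} (f : u ⟶ v) :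
    F.restrict R f ∘ₗ F.extend R f = F.idMap R u := by
  refine LinearMap.ext fun φ => funext fun y => ?_
  rw [LinearMap.comp_apply, restrict_apply, extend_act, LinearMap.id_apply]

theorem restrict_comp_extend_of_ne {t u v : Λ.Vertex} {f : t ⟶ v} {g : u ⟶ v}
    (hd : Λ.degree f = Λ.degree g) (hne : (⟨t, f⟩ : Λ.Into v) ≠ ⟨u, g⟩) :
    F.restrict R f ∘ₗ F.extend R g = 0 := by
  refine LinearMap.ext fun φ => funext fun y => ?_
  rw [LinearMap.comp_apply, restrict_apply, extend_of_not_exists]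
  · rfl
  · rintro ⟨z, hz⟩
    exact hne (F.act_eq hz.symm hd)

/-- The images of the paths of degree `n` partition the points over `v`, so exactly one summand
contributes at each point. -/
theorem sum_extend_comp_restrict [Λ.RowFinite] (v : Λ.Vertex) (n : Fin k → ℕ) :
    ∑ f ∈ (RowFinite.finite (Λ := Λ) v n).toFinset,
      F.block R (F.extend R f.hom ∘ₗ F.restrict R f.hom) = F.block R (F.idMap R v) := by
  refine LinearMap.ext fun φ => funext fun t => funext fun y => ?_
  rw [LinearMap.sum_apply, Finset.sum_apply, Finset.sum_apply]
  by_cases ht : t = v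
  · subst ht
    obtain ⟨u, g, z, hg, rfl⟩ := F.exists_act y n
    rw [Finset.sum_eq_single ⟨u, t, g⟩]
    · rw [block_apply_self, block_apply_self, LinearMap.comp_apply, extend_act, restrict_apply,
        LinearMap.id_apply]
    · rintro ⟨s, t', f⟩ hf hne
      rw [Set.Finite.mem_toFinset] at hf
      obtain ⟨rfl, hf⟩ := hf
      rw [block_apply_self, LinearMap.comp_apply, extend_of_not_exists]
      rintro ⟨a, ha⟩
      have := F.act_eq ha (hf.trans hg.symm)
      obtain rfl : s = u := congrArg Sigma.fst this
      exact hne (by rw [show f = g from eq_of_heq (Sigma.mk.inj this).2])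
    · intro h
      rw [Set.Finite.mem_toFinset] at h
      exact absurd ⟨rfl, hg⟩ h
  · rw [F.block_apply_of_ne ht, Finset.sum_eq_zero]
    · rfl
    · intro f hf
      rw [Set.Finite.mem_toFinset] at hf
      rw [block_apply_of_ne]
      · rfl
      · exact fun h => ht (h.trans hf.1)

variable (R)

/-- The operators on `Fun` by which the generators act. -/
noncomputable def generatorMap : Λ.Generator → Module.End R (F.Fun R)
  | .vertex v => F.block R (F.idMap R v)
  | .path f _ => F.block R (F.extend R f.hom)
  | .ghost f _ => F.block R (F.restrict R f.hom)

/-- The action of the free algebra on `Fun`. -/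
noncomputable def freeRep : Λ.FreeAlg R →ₙₐ[R] Module.End R (F.Fun R) :=
  MonoidAlgebra.liftMagma R (FreeSemigroup.lift (F.generatorMap R))

theorem freeRep_single (g : Λ.Generator) :
    F.freeRep R (MonoidAlgebra.single (FreeSemigroup.of g) 1) = F.generatorMap R g := by
  simp [freeRep]

theorem freeRep_vertex (v : Λ.Vertex) :
    F.freeRep R (FreeAlg.vertex R v) = F.block R (F.idMap R v) :=
  F.freeRep_single R _

theorem freeRep_path (f : Λ.Path) :
    F.freeRep R (FreeAlg.path R f) = F.block R (F.extend R f.hom) := by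
  unfold FreeAlg.path
  split_ifs with hf
  · obtain ⟨v, rfl⟩ := Path.exists_eq_id hf
    rw [freeRep_vertex, extend_id]
  · exact F.freeRep_single R _

theorem freeRep_ghost (f : Λ.Path) :
    F.freeRep R (FreeAlg.ghost R f) = F.block R (F.restrict R f.hom) := by
  unfold FreeAlg.ghost
  split_ifs with hf
  · obtain ⟨v, rfl⟩ := Path.exists_eq_id hf
    rw [freeRep_vertex, restrict_id]
  · exact F.freeRep_single R _

variable [Λ.RowFinite]

theorem freeRep_relator {a : Λ.FreeAlg R} (ha : Λ.IsRelator R a) : F.freeRep R a = 0 := by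
  cases ha with
  | vertex_mul_self v =>
    rw [map_sub, map_mul, freeRep_vertex, block_mul_block, LinearMap.id_comp, sub_self]
  | vertex_mul_vertex v w h =>
    rw [map_sub, map_mul, freeRep_vertex, freeRep_vertex, F.block_mul_block_of_ne h, map_zero,
      sub_self]
  | path_mul_path μ ν hμ hν =>
    rw [map_sub, map_mul, freeRep_path, freeRep_path, freeRep_path, block_mul_block, extend_comp,
      sub_self]
  | ghost_mul_ghost μ ν hμ hν =>
    rw [map_sub, map_mul, freeRep_ghost, freeRep_ghost, freeRep_ghost, block_mul_block,
      restrict_comp, sub_self]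
  | rng_mul_path f hf =>
    rw [map_sub, map_mul, freeRep_path, freeRep_vertex, block_mul_block, LinearMap.id_comp,
      sub_self]
  | path_mul_src f hf =>
    rw [map_sub, map_mul, freeRep_path, freeRep_vertex, block_mul_block, LinearMap.comp_id,
      sub_self]
  | src_mul_ghost f hf =>
    rw [map_sub, map_mul, freeRep_ghost, freeRep_vertex, block_mul_block, LinearMap.id_comp,
      sub_self]
  | ghost_mul_rng f hf =>
    rw [map_sub, map_mul, freeRep_ghost, freeRep_vertex, block_mul_block, LinearMap.comp_id,
      sub_self]
  | ghost_mul_path_self f hf =>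
    rw [map_sub, map_mul, freeRep_ghost, freeRep_path, freeRep_vertex, block_mul_block,
      restrict_comp_extend, sub_self]
  | ghost_mul_path_ne f g hf hd hne =>
    rw [map_sub, map_mul, freeRep_ghost, freeRep_path, map_zero, sub_zero]
    obtain ⟨s, v, f⟩ := f
    obtain ⟨t, v', g⟩ := g
    by_cases h : v = v'
    · subst h
      rw [block_mul_block, F.restrict_comp_extend_of_ne hd]
      · refine LinearMap.ext fun φ => ?_
        simp [block]
      · intro e
        obtain rfl : s = t := congrArg Sigma.fst e
        exact hne (by rw [show f = g from eq_of_heq (Sigma.mk.inj e).2])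
    · exact F.block_mul_block_of_ne h _ _
  | vertex_eq_sum v n hn =>
    rw [map_sub, map_sum, freeRep_vertex, ← F.sum_extend_comp_restrict v n, sub_eq_zero]
    refine Finset.sum_congr rfl fun f _ => ?_
    rw [map_mul, freeRep_path, freeRep_ghost, block_mul_block]

theorem relIdeal_le_ker : Λ.relIdeal R ≤ TwoSidedIdeal.ker (F.freeRep R) := by
  refine TwoSidedIdeal.span_le.mpr ?_
  rintro _ ⟨r, b, hb, rfl⟩
  rw [SetLike.mem_coe, TwoSidedIdeal.mem_ker, map_smul, F.freeRep_relator R hb, smul_zero]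

/-- The representation of the Kumjian-Pask algebra on `Fun`. -/
noncomputable def rep : Λ.KumjianPask R →ₙ+* Module.End R (F.Fun R) where
  toFun := Quotient.lift (F.freeRep R) fun a b h => by
    have h' : a - b ∈ Λ.relIdeal R := (TwoSidedIdeal.rel_iff _ _ _).mp h
    have := F.relIdeal_le_ker R h'
    rwa [TwoSidedIdeal.mem_ker, map_sub, sub_eq_zero] at this
  map_zero' := map_zero (F.freeRep R)
  map_add' := Quotient.ind₂ fun a b => map_add (F.freeRep R) a b
  map_mul' := Quotient.ind₂ fun a b => map_mul (F.freeRep R) a b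

theorem rep_mk (a : Λ.FreeAlg R) : F.rep R (KumjianPask.mk Λ R a) = F.freeRep R a := rfl

theorem rep_smul_p_eq_zero_iff (v : Λ.Vertex) (r : R) :
    F.rep R (r • KumjianPask.p R v) = 0 ↔ r = 0 ∨ IsEmpty (F.pt v) := by
  have h : F.rep R (r • KumjianPask.p R v) = r • F.block R (F.idMap R v) := by
    rw [← F.freeRep_vertex R v, ← map_smul]
    rfl
  rw [h]
  constructor
  · intro h0
    rw [or_iff_not_imp_right, not_isEmpty_iff]
    rintro ⟨y⟩
    -- Applied to the constant function `1` and evaluated over `v`, the operator returns `r`.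
    have := congrFun (congrFun (LinearMap.congr_fun h0 fun _ _ => 1) v) y
    rw [LinearMap.smul_apply, Pi.smul_apply, block_apply_self] at this
    simpa using this
  · rintro (rfl | h)
    · rw [zero_smul]
    · refine LinearMap.ext fun φ => funext fun t => funext fun y => ?_
      rw [LinearMap.smul_apply, Pi.smul_apply]
      by_cases ht : t = v
      · subst ht
        exact h.elim y
      · rw [F.block_apply_of_ne ht, smul_zero]
        rfl

theorem p_mem_ker_iff [Nontrivial R] (v : Λ.Vertex) :
    KumjianPask.p R v ∈ TwoSidedIdeal.ker (F.rep R) ↔ IsEmpty (F.pt v) := by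
  rw [TwoSidedIdeal.mem_ker, ← one_smul R (KumjianPask.p R v), rep_smul_p_eq_zero_iff]
  simp

theorem isBasic_ker : KumjianPask.IsBasic (TwoSidedIdeal.ker (F.rep R)) := by
  intro v r hr h
  rw [TwoSidedIdeal.mem_ker, rep_smul_p_eq_zero_iff, or_iff_right hr] at h
  rw [TwoSidedIdeal.mem_ker, ← one_smul R (KumjianPask.p R v), rep_smul_p_eq_zero_iff]
  exact Or.inr h

end PathSpace

end Representation

/-! ### Basic simplicity implies cofinality and aperiodicity -/

section Necessity

variable {k : ℕ} {Λ : KGraph.{u, w} k}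

theorem Ray.eq_of_cons_eq {t u v : Λ.Vertex} {f : t ⟶ v} {g : u ⟶ v} {y : Λ.Ray t} {z : Λ.Ray u}
    (h : cons f y = cons g z) (hd : Λ.degree f = Λ.degree g) : (⟨t, f⟩ : Λ.Into v) = ⟨u, g⟩ := by
  rw [← init_cons_degree f y, h, hd, init_cons_degree]

namespace PathSpace

variable (Λ) in
/-- The path space of all infinite paths. -/
noncomputable def rays : PathSpace Λ where
  pt := Λ.Ray
  act := Ray.cons
  act_comp := Ray.cons_comp
  act_injective := Ray.cons_injective
  exists_act y n := by
    obtain ⟨z, hz⟩ := y.exists_eq_cons n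
    exact ⟨_, _, z, y.degree_init n, hz⟩
  act_eq := Ray.eq_of_cons_eq

variable (Λ) in
/-- The path space of infinite paths together with a degree in `ℤ^k`. -/
noncomputable def gradedRays : PathSpace Λ where
  pt v := Λ.Ray v × (Fin k → ℤ)
  act f y := (Ray.cons f y.1, (fun i => (Λ.degree f i : ℤ)) + y.2)
  act_comp g f y := by
    refine Prod.ext (Ray.cons_comp g f y.1) (funext fun i => ?_)
    simp only [Λ.degree_comp, Pi.add_apply, Nat.cast_add, add_assoc]
  act_injective f y z h :=
    Prod.ext (Ray.cons_injective f (congrArg Prod.fst h)) (add_left_cancel (congrArg Prod.snd h))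
  exists_act {v} y n := by
    obtain ⟨z, hz⟩ := y.1.exists_eq_cons n
    exact ⟨_, (y.1.init n).2, (z, y.2 - fun i => (Λ.degree (y.1.init n).2 i : ℤ)),
      y.1.degree_init n, Prod.ext hz (add_sub_cancel _ _)⟩
  act_eq h hd := Ray.eq_of_cons_eq (congrArg Prod.fst h) hd

variable (Λ) in
/-- The path space of infinite paths none of whose vertices is the source of a path with
range `t`. -/
noncomputable def raysAvoiding (t : Λ.Vertex) : PathSpace Λ where
  pt v := {y : Λ.Ray v // ∀ n, IsEmpty ((y.init n).1 ⟶ t)}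
  act f y := ⟨Ray.cons f y.1, fun n => ⟨fun g => by
    obtain ⟨h, -⟩ := Ray.cons_isPrefix f y.1 (le_refl n)
    exact (y.2 n).elim (h ≫ g)⟩⟩
  act_comp g f y := Subtype.ext (Ray.cons_comp g f y.1)
  act_injective f _ _ h := Subtype.ext (Ray.cons_injective f (congrArg Subtype.val h))
  exists_act {v} y n := by
    obtain ⟨z, hz⟩ := y.1.exists_eq_cons n
    refine ⟨_, _, ⟨z, fun m => ⟨fun g => ?_⟩⟩, y.1.degree_init n, Subtype.ext hz⟩
    have h := y.2 (m + Λ.degree (y.1.init n).2)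
    have e := Ray.init_cons_add (y.1.init n).2 z m
    rw [hz] at e
    rw [e] at h
    exact h.elim g
  act_eq h hd := Ray.eq_of_cons_eq (congrArg Subtype.val h) hd

end PathSpace

namespace KumjianPask

variable (R : Type x) [CommRing R] [Λ.RowFinite]

/-- The generator `s_f`, which is `p_v` if `f` is the identity at `v`. -/
noncomputable def path {v w : Λ.Vertex} (f : v ⟶ w) : Λ.KumjianPask R :=
  mk Λ R (FreeAlg.path R ⟨v, w, f⟩)

/-- The generator `s_{f*}`, which is `p_v` if `f` is the identity at `v`. -/
noncomputable def ghost {v w : Λ.Vertex} (f : v ⟶ w) : Λ.KumjianPask R :=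
  mk Λ R (FreeAlg.ghost R ⟨v, w, f⟩)

theorem p_ne_zero [Λ.NoSources] [Nontrivial R] (v : Λ.Vertex) : p R v ≠ 0 := by
  intro h
  have := ((PathSpace.rays Λ).p_mem_ker_iff R v).mp (h ▸ TwoSidedIdeal.zero_mem _)
  exact this.elim (Ray.nonempty v).some

theorem path_ne_path [Λ.NoSources] [Nontrivial R] {v w : Λ.Vertex} {f g : v ⟶ w}
    (h : Λ.degree f ≠ Λ.degree g) : path R f ≠ path R g := by
  intro he
  let F := PathSpace.gradedRays Λ
  have hF : F.block R (F.extend R f) = F.block R (F.extend R g) := by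
    have := congrArg (F.rep R) he
    rwa [path, path, F.rep_mk, F.rep_mk, F.freeRep_path, F.freeRep_path] at this
  obtain ⟨y⟩ := Ray.nonempty v
  -- The indicator of degree zero: extending it along `f` gives a function supported in degree
  -- `d(f)`, which separates `f` from `g`.
  let φ : F.Fun R := fun _ a => if a.2 = 0 then 1 else 0
  let y₀ : F.pt v := (y, 0)
  have h1 := congrFun (congrFun (LinearMap.congr_fun hF φ) w) (F.act f y₀)
  rw [F.block_apply_self, F.block_apply_self, F.extend_act] at h1
  have h2 : φ v y₀ = 1 := if_pos rfl
  rw [h2] at h1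
  by_cases hz : ∃ a, F.act g a = F.act f y₀
  · obtain ⟨a, ha⟩ := hz
    rw [← ha, F.extend_act] at h1
    refine one_ne_zero (h1.trans (if_neg fun h0 => h ?_))
    have hd := congrArg Prod.snd ha
    funext i
    have hi := congrFun hd i
    have : (Λ.degree g i : ℤ) + a.2 i = Λ.degree f i + 0 := hi
    rw [h0] at this
    exact_mod_cast (by simpa using this.symm)
  · rw [F.extend_of_not_exists g _ hz] at h1
    exact one_ne_zero h1

/-- Without sources every vertex carries an infinite path, so the kernel on all infinite paths
contains no vertex and must be zero. -/
theorem path_eq_path_of_isBasicallySimple [Λ.NoSources] [Nontrivial R]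
    (h : IsBasicallySimple Λ R) {v w : Λ.Vertex} {f g : v ⟶ w}
    (hfg : ∀ y : Λ.Ray v, Ray.cons f y = Ray.cons g y) : path R f = path R g := by
  let F := PathSpace.rays Λ
  have hmem : path R f - path R g ∈ TwoSidedIdeal.ker (F.rep R) := by
    have : F.extend R f = F.extend R g := by
      have : F.act f = F.act g := funext hfg
      unfold PathSpace.extend
      rw [this]
    rw [TwoSidedIdeal.mem_ker, map_sub, path, path, F.rep_mk, F.rep_mk, F.freeRep_path,
      F.freeRep_path, sub_eq_zero]
    exact congrArg _ this
  rcases h _ (F.isBasic_ker R) with h | h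
  · rw [h, TwoSidedIdeal.mem_bot, sub_eq_zero] at hmem
    exact hmem
  · have hw : p R w ∈ TwoSidedIdeal.ker (F.rep R) := h ▸ trivial
    exact (((F.p_mem_ker_iff R w).mp hw).elim (Ray.nonempty w).some)

theorem IsBasicallySimple.isCofinal [Λ.NoSources] [Nontrivial R]
    (h : IsBasicallySimple Λ R) : Λ.IsCofinal := by
  intro y v
  by_contra! hy
  let F := PathSpace.raysAvoiding Λ v
  have hv : p R v ∈ TwoSidedIdeal.ker (F.rep R) :=
    (F.p_mem_ker_iff R v).mpr ⟨fun z => (z.2 0).elim (z.1.init 0).2⟩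
  rcases h _ (F.isBasic_ker R) with h | h
  · rw [h, TwoSidedIdeal.mem_bot] at hv
    exact p_ne_zero R v hv
  · have h0 : p R (y.vertex 0) ∈ TwoSidedIdeal.ker (F.rep R) := h ▸ trivial
    exact ((F.p_mem_ker_iff R _).mp h0).elim ⟨Ray.ofInfinitePath y, fun n => hy n⟩

end KumjianPask

theorem Path.segment_eq {f g : Λ.Path} {p q : Fin k → ℕ} {hpq : p ≤ q} {hq : q ≤ f.deg}
    (h : f.IsSegment p q g) : f.segment p q hpq hq = g :=
  (f.existsUnique_isSegment hpq hq).unique (f.existsUnique_isSegment hpq hq).choose_spec.1 h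

theorem Path.isSegment_comp {s a b t : Λ.Vertex} (c : s ⟶ a) (g : a ⟶ b) (e : b ⟶ t)
    {p q : Fin k → ℕ} (hp : Λ.degree e = p) (hq : p + Λ.degree g = q) {f : s ⟶ t}
    (hf : c ≫ g ≫ e = f) : Path.IsSegment ⟨s, t, f⟩ p q ⟨a, b, g⟩ := by
  refine ⟨e, c, hp, ?_, ?_, hf⟩
  · rw [← hq, add_tsub_cancel_left]
    rfl
  · change _ = Λ.degree f - q
    rw [← hf, Λ.degree_comp, Λ.degree_comp, hp, hq, add_tsub_cancel_left]

/-- Let aperiodicity fail at `v`, `m`, `n`, and factor a path `f` of degree `m ∨ n` as `μα = νβ`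
with `d(μ) = m`, `d(ν) = n`. Equality of the segments of all extensions `fg` forces `αy = βy`, so
`μα` and `να` act alike: `μαy = νβy = ναy`. -/
theorem exists_cons_eq_cons_of_not_isAperiodic [Λ.NoSources] (h : ¬ Λ.IsAperiodic) :
    ∃ (u v : Λ.Vertex) (f g : u ⟶ v), Λ.degree f ≠ Λ.degree g ∧
      ∀ y : Λ.Ray u, Ray.cons f y = Ray.cons g y := by
  unfold IsAperiodic at h
  push Not at h
  obtain ⟨v, m, n, hmn, h⟩ := h
  obtain ⟨⟨u, v', f⟩, hv, hf⟩ := NoSources.nonempty (Λ := Λ) v (m ⊔ n)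
  obtain rfl : v' = v := hv
  change Λ.degree f = m ⊔ n at hf
  obtain ⟨a, α, μ, hμ, hα⟩ := exists_factor f (n := m) (by rw [hf]; exact le_sup_left)
  obtain ⟨b, β, ν, hν, hβ⟩ := exists_factor f (n := n) (by rw [hf]; exact le_sup_right)
  -- The two segments of `fg` compared by the failure of aperiodicity are the initial segments of
  -- degree `d(g)` of `αg` and `βg`.
  have key : ∀ {t : Λ.Vertex} (g : t ⟶ u) {a' b' : Λ.Vertex} (h₁ : t ⟶ a') (e₁ : a' ⟶ a)
      (h₂ : t ⟶ b') (e₂ : b' ⟶ b), Λ.degree e₁ = Λ.degree g → Λ.degree e₂ = Λ.degree g →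
      h₁ ≫ e₁ = g ≫ α → h₂ ≫ e₂ = g ≫ β → (⟨a', a, e₁⟩ : Λ.Path) = ⟨b', b, e₂⟩ := by
    intro t g a' b' h₁ e₁ h₂ e₂ hd₁ hd₂ he₁ he₂
    have hdeg : Path.deg ⟨t, v', g ≫ f⟩ = m ⊔ n + Λ.degree g := by
      change Λ.degree (g ≫ f) = _
      rw [Λ.degree_comp, hf]
    have hsub : Path.deg ⟨t, v', g ≫ f⟩ - m ⊔ n = Λ.degree g := by
      rw [hdeg, add_tsub_cancel_left]
    have := h ⟨t, v', g ≫ f⟩ rfl (hdeg ▸ le_self_add)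
    rwa [Path.segment_eq (Path.isSegment_comp h₁ e₁ μ hμ (by rw [hsub, hd₁])
        (by rw [← Category.assoc, he₁, Category.assoc, hα])),
      Path.segment_eq (Path.isSegment_comp h₂ e₂ ν hν (by rw [hsub, hd₂])
        (by rw [← Category.assoc, he₂, Category.assoc, hβ]))] at this
  -- For `g` an identity the segments are vertices; their equality makes `να` composable.
  obtain rfl : a = b := congrArg Path.rng (key (𝟙 u) α (𝟙 a) β (𝟙 b)
    (by rw [Λ.degree_id, Λ.degree_id]) (by rw [Λ.degree_id, Λ.degree_id]) (by simp) (by simp))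
  refine ⟨u, v', α ≫ μ, α ≫ ν, ?_, fun y => ?_⟩
  · rw [Λ.degree_comp, Λ.degree_comp, hμ, hν]
    exact fun e => hmn (add_right_cancel e)
  · have hy : Ray.cons α y = Ray.cons β y := by
      ext1
      funext N
      obtain ⟨h₁, e₁⟩ := Ray.cons_isPrefix α y (le_refl N)
      obtain ⟨h₂, e₂⟩ := Ray.cons_isPrefix β y (le_refl N)
      have := key (y.init N).2 h₁ ((Ray.cons α y).init N).2 h₂ ((Ray.cons β y).init N).2
        (by rw [Ray.degree_init, Ray.degree_init]) (by rw [Ray.degree_init, Ray.degree_init]) e₁ e₂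
      have h3 := Path.mk.inj this
      exact Sigma.ext h3.1 h3.2.2
    rw [hα, Ray.cons_comp, hy, ← Ray.cons_comp, hβ]

theorem KumjianPask.IsBasicallySimple.isAperiodic (R : Type x) [CommRing R] [Λ.RowFinite]
    [Λ.NoSources] [Nontrivial R] (h : IsBasicallySimple Λ R) : Λ.IsAperiodic := by
  by_contra hΛ
  obtain ⟨u, v, f, g, hd, hfg⟩ := exists_cons_eq_cons_of_not_isAperiodic hΛ
  exact path_ne_path R hd (path_eq_path_of_isBasicallySimple R h hfg)

end Necessity

/-- The motive varies over both endpoints, since a path of degree zero is an identity only once they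
are identified. -/
theorem hom_zero_cases {k : ℕ} {Λ : KGraph.{u, w} k} {motive : ∀ v w : Λ.Vertex, (v ⟶ w) → Prop}
    {v w : Λ.Vertex} (f : v ⟶ w) (hf : Λ.degree f = 0) (h : ∀ v, motive v v (𝟙 v)) :
    motive v w f := by
  obtain ⟨t, ht⟩ := Path.exists_eq_id (f := ⟨v, w, f⟩) hf
  obtain ⟨rfl, rfl, e⟩ := Path.mk.inj ht
  rw [eq_of_heq e]
  exact h _

namespace KumjianPask

/-! ### The Kumjian-Pask relations, extended to paths of degree zero -/

section Relations

variable {k : ℕ} {Λ : KGraph.{u, w} k} [Λ.RowFinite] (R : Type x) [CommRing R]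

theorem mk_eq_of_isRelator {a b : Λ.FreeAlg R} (h : Λ.IsRelator R (a - b)) :
    mk Λ R a = mk Λ R b := by
  refine Quotient.sound ?_
  change (Λ.relIdeal R).ringCon a b
  rw [TwoSidedIdeal.rel_iff]
  exact TwoSidedIdeal.subset_span ⟨1, a - b, h, (one_smul R _).symm⟩

theorem path_id (v : Λ.Vertex) : path R (𝟙 v) = p R v := by
  have : Path.deg ⟨v, v, 𝟙 v⟩ = 0 := Λ.degree_id v
  rw [path, FreeAlg.path, dif_pos this, p]

theorem ghost_id (v : Λ.Vertex) : ghost R (𝟙 v) = p R v := by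
  have : Path.deg ⟨v, v, 𝟙 v⟩ = 0 := Λ.degree_id v
  rw [ghost, FreeAlg.ghost, dif_pos this, p]

theorem p_mul_self (v : Λ.Vertex) : p R v * p R v = p R v :=
  mk_eq_of_isRelator R (.vertex_mul_self v)

theorem p_mul_p_of_ne {v w : Λ.Vertex} (h : v ≠ w) : p R v * p R w = 0 :=
  mk_eq_of_isRelator R (.vertex_mul_vertex v w h)

variable {t u v : Λ.Vertex}

theorem p_mul_path (f : u ⟶ v) : p R v * path R f = path R f := by
  by_cases hf : Λ.degree f = 0
  · refine hom_zero_cases (motive := fun _ v f => p R v * path R f = path R f) f hf fun v => ?_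
    rw [path_id, p_mul_self]
  · exact mk_eq_of_isRelator R (.rng_mul_path ⟨u, v, f⟩ hf)

theorem path_mul_p (f : u ⟶ v) : path R f * p R u = path R f := by
  by_cases hf : Λ.degree f = 0
  · refine hom_zero_cases (motive := fun u _ f => path R f * p R u = path R f) f hf fun v => ?_
    rw [path_id, p_mul_self]
  · exact mk_eq_of_isRelator R (.path_mul_src ⟨u, v, f⟩ hf)

theorem p_mul_ghost (f : u ⟶ v) : p R u * ghost R f = ghost R f := by
  by_cases hf : Λ.degree f = 0
  · refine hom_zero_cases (motive := fun u _ f => p R u * ghost R f = ghost R f) f hf fun v => ?_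
    rw [ghost_id, p_mul_self]
  · exact mk_eq_of_isRelator R (.src_mul_ghost ⟨u, v, f⟩ hf)

theorem ghost_mul_p (f : u ⟶ v) : ghost R f * p R v = ghost R f := by
  by_cases hf : Λ.degree f = 0
  · refine hom_zero_cases (motive := fun _ v f => ghost R f * p R v = ghost R f) f hf fun v => ?_
    rw [ghost_id, p_mul_self]
  · exact mk_eq_of_isRelator R (.ghost_mul_rng ⟨u, v, f⟩ hf)

theorem path_mul_path (g : t ⟶ u) (f : u ⟶ v) : path R f * path R g = path R (g ≫ f) := by
  by_cases hf : Λ.degree f = 0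
  · refine hom_zero_cases (motive := fun u v f => ∀ g : t ⟶ u,
      path R f * path R g = path R (g ≫ f)) f hf (fun v g => ?_) g
    rw [path_id, p_mul_path, Category.comp_id]
  by_cases hg : Λ.degree g = 0
  · refine hom_zero_cases (motive := fun t u g => ∀ f : u ⟶ v,
      path R f * path R g = path R (g ≫ f)) g hg (fun v f => ?_) f
    rw [path_id, path_mul_p, Category.id_comp]
  exact mk_eq_of_isRelator R (.path_mul_path g f hg hf)

theorem ghost_mul_ghost (g : t ⟶ u) (f : u ⟶ v) : ghost R g * ghost R f = ghost R (g ≫ f) := by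
  by_cases hf : Λ.degree f = 0
  · refine hom_zero_cases (motive := fun u v f => ∀ g : t ⟶ u,
      ghost R g * ghost R f = ghost R (g ≫ f)) f hf (fun v g => ?_) g
    rw [ghost_id, ghost_mul_p, Category.comp_id]
  by_cases hg : Λ.degree g = 0
  · refine hom_zero_cases (motive := fun t u g => ∀ f : u ⟶ v,
      ghost R g * ghost R f = ghost R (g ≫ f)) g hg (fun v f => ?_) f
    rw [ghost_id, p_mul_ghost, Category.id_comp]
  exact mk_eq_of_isRelator R (.ghost_mul_ghost g f hg hf)

theorem ghost_mul_path_self (f : u ⟶ v) : ghost R f * path R f = p R u := by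
  by_cases hf : Λ.degree f = 0
  · refine hom_zero_cases (motive := fun u _ f => ghost R f * path R f = p R u) f hf fun v => ?_
    rw [ghost_id, path_id, p_mul_self]
  · exact mk_eq_of_isRelator R (.ghost_mul_path_self ⟨u, v, f⟩ hf)

theorem ghost_mul_path_of_ne {f : t ⟶ v} {g : u ⟶ v} (hd : Λ.degree f = Λ.degree g)
    (hne : (⟨t, f⟩ : Λ.Into v) ≠ ⟨u, g⟩) : ghost R f * path R g = 0 := by
  by_cases hf : Λ.degree f = 0
  · have e : ∀ {s : Λ.Vertex} (f : s ⟶ v), Λ.degree f = 0 → (⟨s, f⟩ : Λ.Into v) = ⟨v, 𝟙 v⟩ :=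
      fun f hf => hom_zero_cases (motive := fun s v f => (⟨s, f⟩ : Λ.Into v) = ⟨v, 𝟙 v⟩)
        f hf fun _ => rfl
    exact absurd ((e f hf).trans (e g (hd ▸ hf)).symm) hne
  · refine mk_eq_of_isRelator R (.ghost_mul_path_ne ⟨t, v, f⟩ ⟨u, v, g⟩ hf hd fun h => hne ?_)
    have h := Path.mk.inj h
    exact Sigma.ext h.1 h.2.2

theorem mul_eq_zero_of_ne {a b : Λ.KumjianPask R} {v w : Λ.Vertex} (ha : a * p R v = a)
    (hb : p R w * b = b) (h : v ≠ w) : a * b = 0 := by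
  rw [← ha, ← hb, mul_assoc, ← mul_assoc (p R v), p_mul_p_of_ne R h, zero_mul, mul_zero]

theorem p_eq_sum (v : Λ.Vertex) {n : Fin k → ℕ} (hn : n ≠ 0) :
    p R v = ∑ f ∈ (RowFinite.finite (Λ := Λ) v n).toFinset, path R f.hom * ghost R f.hom := by
  have h : ∀ s : Finset Λ.Path, mk Λ R (∑ f ∈ s, FreeAlg.path R f * FreeAlg.ghost R f) =
      ∑ f ∈ s, path R f.hom * ghost R f.hom := by
    intro s
    classical
    induction s using Finset.induction_on with
    | empty => rfl
    | insert f s hf ih =>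
      rw [Finset.sum_insert hf, Finset.sum_insert hf, ← ih]
      rfl
  rw [← h]
  exact mk_eq_of_isRelator R (.vertex_eq_sum v n hn)

variable {R}

@[elab_as_elim]
theorem induction {motive : Λ.KumjianPask R → Prop} (a : Λ.KumjianPask R)
    (vertex : ∀ v, motive (p R v)) (path : ∀ {v w : Λ.Vertex} (f : v ⟶ w), motive (path R f))
    (ghost : ∀ {v w : Λ.Vertex} (f : v ⟶ w), motive (ghost R f))
    (zero : motive 0) (add : ∀ a b, motive a → motive b → motive (a + b))
    (mul : ∀ a b, motive a → motive b → motive (a * b))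
    (smul : ∀ (r : R) a, motive a → motive (r • a)) : motive a := by
  have gen : ∀ g : Λ.Generator,
      motive (mk Λ R (MonoidAlgebra.single (FreeSemigroup.of g) 1)) := by
    rintro (v | ⟨f, hf⟩ | ⟨f, hf⟩)
    · exact vertex v
    · have := path f.hom
      rwa [KumjianPask.path, FreeAlg.path, dif_neg hf] at this
    · have := ghost f.hom
      rwa [KumjianPask.ghost, FreeAlg.ghost, dif_neg hf] at this
  have word : ∀ x : FreeSemigroup Λ.Generator,
      motive (mk Λ R (MonoidAlgebra.single x 1)) := by
    intro x
    induction x using FreeSemigroup.recOnMul with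
    | ih1 g => exact gen g
    | ih2 g y hg hy =>
      have e : (MonoidAlgebra.single (FreeSemigroup.of g * y) 1 : Λ.FreeAlg R) =
          MonoidAlgebra.single (FreeSemigroup.of g) 1 * MonoidAlgebra.single y 1 := by
        rw [MonoidAlgebra.single_mul_single, mul_one]
      rw [e]
      exact mul _ _ hg hy
  refine Quotient.inductionOn a fun x => ?_
  change motive (mk Λ R x)
  induction x using MonoidAlgebra.induction_linear with
  | zero => exact zero
  | add x y hx hy => exact add _ _ hx hy
  | single g r =>
    have e : (MonoidAlgebra.single g r : Λ.FreeAlg R) = r • MonoidAlgebra.single g 1 := by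
      rw [MonoidAlgebra.smul_single, smul_eq_mul, mul_one]
    rw [e]
    exact smul r _ (word g)

end Relations

end KumjianPask

namespace KumjianPask

/-! ### Cofinality and aperiodicity imply basic simplicity -/

section Sufficiency

variable {k : ℕ} {Λ : KGraph.{u, w} k} [Λ.RowFinite] (R : Type x) [CommRing R]

variable (Λ) in
/-- The span of the elements `s_f` with `d(f) ≥ m`. -/
noncomputable def pathSpan (m : Fin k → ℕ) : Submodule R (Λ.KumjianPask R) :=
  Submodule.span R {a | ∃ f : Λ.Path, m ≤ f.deg ∧ path R f.hom = a}

theorem path_mem_pathSpan {m : Fin k → ℕ} {u v : Λ.Vertex} (f : u ⟶ v) (h : m ≤ Λ.degree f) :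
    path R f ∈ pathSpan Λ R m :=
  Submodule.subset_span ⟨⟨u, v, f⟩, h, rfl⟩

variable {R}

/-- A long enough path absorbs all ghosts in `a`. The bound `m` on the surviving degrees is what
makes the induction pass through products: `b` must leave paths still long enough for `a`. -/
theorem exists_mul_path_mem_pathSpan (a : Λ.KumjianPask R) : ∀ m : Fin k → ℕ, ∃ n : Fin k → ℕ,
    ∀ {u v : Λ.Vertex} (g : u ⟶ v), n ≤ Λ.degree g → a * path R g ∈ pathSpan Λ R m := by
  induction a using KumjianPask.induction with
  | vertex w =>
    refine fun m => ⟨m, fun {u v} g hg => ?_⟩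
    by_cases h : w = v
    · subst h
      rw [p_mul_path]
      exact path_mem_pathSpan R g hg
    · rw [mul_eq_zero_of_ne R (p_mul_self R w) (p_mul_path R g) h]
      exact Submodule.zero_mem _
  | @path s t f =>
    refine fun m => ⟨m, fun {u v} g hg => ?_⟩
    by_cases h : s = v
    · subst h
      rw [path_mul_path]
      refine path_mem_pathSpan R _ (hg.trans ?_)
      rw [Λ.degree_comp]
      exact le_add_self
    · rw [mul_eq_zero_of_ne R (path_mul_p R f) (p_mul_path R g) h]
      exact Submodule.zero_mem _
  | @ghost s t f =>
    refine fun m => ⟨Λ.degree f + m, fun {u v} g hg => ?_⟩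
    by_cases h : t = v
    · subst h
      obtain ⟨r, g₂, g₁, hd, rfl⟩ := exists_factor g (le_self_add.trans hg)
      rw [← path_mul_path, ← mul_assoc]
      by_cases e : (⟨s, f⟩ : Λ.Into t) = ⟨r, g₁⟩
      · obtain rfl : s = r := congrArg Sigma.fst e
        obtain rfl : f = g₁ := eq_of_heq (Sigma.mk.inj e).2
        rw [ghost_mul_path_self, p_mul_path]
        rw [Λ.degree_comp] at hg
        exact path_mem_pathSpan R _ (le_of_add_le_add_left hg)
      · rw [ghost_mul_path_of_ne R hd.symm e, zero_mul]
        exact Submodule.zero_mem _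
    · rw [mul_eq_zero_of_ne R (ghost_mul_p R f) (p_mul_path R g) h]
      exact Submodule.zero_mem _
  | zero =>
    refine fun m => ⟨0, fun g _ => ?_⟩
    rw [zero_mul]
    exact Submodule.zero_mem _
  | add a b ha hb =>
    intro m
    obtain ⟨n₁, h₁⟩ := ha m
    obtain ⟨n₂, h₂⟩ := hb m
    refine ⟨n₁ ⊔ n₂, fun g hg => ?_⟩
    rw [add_mul]
    exact Submodule.add_mem _ (h₁ g (le_sup_left.trans hg)) (h₂ g (le_sup_right.trans hg))
  | mul a b ha hb =>
    intro m
    obtain ⟨n₁, h₁⟩ := ha m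
    obtain ⟨n₂, h₂⟩ := hb n₁
    have hle : pathSpan Λ R n₁ ≤ (pathSpan Λ R m).comap (LinearMap.mulLeft R a) := by
      refine Submodule.span_le.mpr ?_
      rintro _ ⟨f, hf, rfl⟩
      exact h₁ f.hom hf
    refine ⟨n₂, fun g hg => ?_⟩
    rw [mul_assoc]
    exact hle (h₂ g hg)
  | smul r a ha =>
    intro m
    obtain ⟨n, h⟩ := ha m
    refine ⟨n, fun g hg => ?_⟩
    rw [smul_mul_assoc]
    exact Submodule.smul_mem _ r (h g hg)

theorem mul_sum_p {a : Λ.KumjianPask R} {v : Λ.Vertex} (h : a * p R v = a)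
    {V : Finset Λ.Vertex} (hv : v ∈ V) : a * ∑ w ∈ V, p R w = a := by
  rw [← h, mul_assoc, Finset.mul_sum, Finset.sum_eq_single v, p_mul_self]
  · exact fun w _ hw => p_mul_p_of_ne R hw.symm
  · exact fun hn => absurd hv hn

/-- Right local units. Allowing all larger sets lets two summands share one unit. -/
theorem exists_mul_sum_p_eq (a : Λ.KumjianPask R) :
    ∃ V : Finset Λ.Vertex, ∀ V', V ⊆ V' → a * ∑ v ∈ V', p R v = a := by
  induction a using KumjianPask.induction with
  | vertex v =>
    exact ⟨{v}, fun V h => mul_sum_p (p_mul_self R v) (Finset.singleton_subset_iff.mp h)⟩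
  | path f =>
    exact ⟨{_}, fun V h => mul_sum_p (path_mul_p R f) (Finset.singleton_subset_iff.mp h)⟩
  | ghost f =>
    exact ⟨{_}, fun V h => mul_sum_p (ghost_mul_p R f) (Finset.singleton_subset_iff.mp h)⟩
  | zero => exact ⟨∅, fun _ _ => zero_mul _⟩
  | add a b ha hb =>
    classical
    obtain ⟨V₁, h₁⟩ := ha
    obtain ⟨V₂, h₂⟩ := hb
    refine ⟨V₁ ∪ V₂, fun V h => ?_⟩
    rw [add_mul, h₁ V (Finset.union_subset_left h), h₂ V (Finset.union_subset_right h)]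
  | mul a b ha hb =>
    obtain ⟨V, h⟩ := hb
    exact ⟨V, fun V' hV => by rw [mul_assoc, h V' hV]⟩
  | smul r a ha =>
    obtain ⟨V, h⟩ := ha
    exact ⟨V, fun V' hV => by rw [smul_mul_assoc, h V' hV]⟩

theorem exists_mul_path_ne_zero {a : Λ.KumjianPask R} (ha : a ≠ 0) {n : Fin k → ℕ} (hn : n ≠ 0) :
    ∃ (u v : Λ.Vertex) (g : u ⟶ v), Λ.degree g = n ∧ a * path R g ≠ 0 := by
  obtain ⟨V, hV⟩ := exists_mul_sum_p_eq a
  contrapose! ha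
  rw [← hV V subset_rfl, Finset.mul_sum]
  refine Finset.sum_eq_zero fun v _ => ?_
  rw [p_eq_sum R v hn, Finset.mul_sum]
  refine Finset.sum_eq_zero fun f hf => ?_
  rw [Set.Finite.mem_toFinset] at hf
  rw [← mul_assoc, ha _ _ f.hom hf.2, zero_mul]

variable (R)

theorem exists_isPrefix_of_ghost_mul_path_ne_zero {s t v : Λ.Vertex} {a : s ⟶ v} {b : t ⟶ v}
    (h : ghost R a * path R b ≠ 0) {l : Fin k → ℕ} (ha : l ≤ Λ.degree a) (hb : l ≤ Λ.degree b) :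
    ∃ e : Λ.Into v, Λ.degree e.2 = l ∧ IsPrefix e ⟨s, a⟩ ∧ IsPrefix e ⟨t, b⟩ := by
  obtain ⟨e, he, hea⟩ := exists_isPrefix (⟨s, a⟩ : Λ.Into v) ha
  obtain ⟨e', he', heb⟩ := exists_isPrefix (⟨t, b⟩ : Λ.Into v) hb
  by_cases hee : e = e'
  · exact ⟨e, he, hea, hee ▸ heb⟩
  · refine absurd ?_ h
    obtain ⟨g, hg⟩ := hea
    obtain ⟨g', hg'⟩ := heb
    dsimp only at g hg g' hg'
    rw [← hg, ← hg', ← ghost_mul_ghost, ← path_mul_path, mul_assoc, ← mul_assoc (ghost R e.2),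
      ghost_mul_path_of_ne R (he.trans he'.symm) hee, zero_mul, mul_zero]

/-- Take `c` from aperiodicity at `u` for the shifts `m ∨ n - m` and `m ∨ n - n`. A nonzero product
would give `fc` and `gc` a long common initial segment; its part beyond degree `m ∨ n` would occur
in `c` at both shifts, contrary to the choice of `c`. -/
theorem exists_ghost_mul_path_eq_zero (hΛ : Λ.IsAperiodic) {u v : Λ.Vertex} {f g : u ⟶ v}
    (hd : Λ.degree f ≠ Λ.degree g) :
    ∃ (s : Λ.Vertex) (c : s ⟶ u), ghost R (c ≫ f) * path R (c ≫ g) = 0 := by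
  set m := Λ.degree f with hm
  set n := Λ.degree g with hn
  obtain ⟨⟨s, u', c⟩, hu, hsup, hseg⟩ := hΛ u (m ⊔ n - m) (m ⊔ n - n) (by
    intro h
    refine hd (funext fun i => ?_)
    have := congrFun h i
    simp only [Pi.sub_apply, Pi.sup_apply] at this
    omega)
  obtain rfl : u' = u := hu
  refine ⟨s, c, ?_⟩
  by_contra hne
  have hsup' : ∀ i, max (max (m i) (n i) - m i) (max (m i) (n i) - n i) ≤ Λ.degree c i := hsup
  -- The degree `m ∧ n + d(c)` is the largest one bounded by both `d(fc)` and `d(gc)`, and it is at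
  -- least `m ∨ n`.
  obtain ⟨e, he, ⟨h₁, e₁⟩, ⟨h₂, e₂⟩⟩ := exists_isPrefix_of_ghost_mul_path_ne_zero R hne
    (l := m ⊓ n + Λ.degree c)
    (by rw [Λ.degree_comp]; exact add_le_add_left inf_le_left _)
    (by rw [Λ.degree_comp]; exact add_le_add_left inf_le_right _)
  obtain ⟨d, hdd, hde⟩ := exists_isPrefix e (n := m ⊔ n) (by
    rw [he]
    intro i
    have := hsup' i
    simp only [Pi.add_apply, Pi.sup_apply, Pi.inf_apply]
    omega)
  have hfd : IsPrefix (⟨u', f⟩ : Λ.Into v) d :=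
    IsPrefix.of_degree_le (c := ⟨s, c ≫ f⟩) ⟨c, rfl⟩ (hde.trans ⟨h₁, e₁⟩)
      (by rw [hdd]; exact le_sup_left)
  have hgd : IsPrefix (⟨u', g⟩ : Λ.Into v) d :=
    IsPrefix.of_degree_le (c := ⟨s, c ≫ g⟩) ⟨c, rfl⟩ (hde.trans ⟨h₂, e₂⟩)
      (by rw [hdd]; exact le_sup_right)
  obtain ⟨b, hb⟩ := hde
  obtain ⟨a₁, ha₁⟩ := hfd
  obtain ⟨a₂, ha₂⟩ := hgd
  dsimp only at a₁ ha₁ a₂ ha₂ e₁ e₂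
  -- Cancelling `f` and `g` exhibits `b` as a middle factor of `c` in two positions.
  have hc₁ : h₁ ≫ b ≫ a₁ = c := comp_right_cancel (f := f) (by simp [ha₁, hb, e₁])
  have hc₂ : h₂ ≫ b ≫ a₂ = c := comp_right_cancel (f := g) (by simp [ha₂, hb, e₂])
  have hda₁ : m + Λ.degree a₁ = m ⊔ n := by rw [← hdd, ← ha₁, Λ.degree_comp]
  have hda₂ : n + Λ.degree a₂ = m ⊔ n := by rw [← hdd, ← ha₂, Λ.degree_comp]
  have hdb : m ⊔ n + Λ.degree b = m ⊓ n + Λ.degree c := by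
    rw [← he, ← hb, Λ.degree_comp, hdd]
  have hdb' : Λ.degree b = Path.deg ⟨s, u', c⟩ - (m ⊔ n - m) ⊔ (m ⊔ n - n) := by
    funext i
    have h3 := congrFun hdb i
    have h4 := hsup' i
    simp only [Pi.add_apply, Pi.sup_apply, Pi.inf_apply, Pi.sub_apply, Path.deg] at h3 h4 ⊢
    omega
  refine hseg ?_
  rw [Path.segment_eq (Path.isSegment_comp h₁ b a₁ (by rw [← hda₁, add_tsub_cancel_left])
      (by rw [hdb']) hc₁),
    Path.segment_eq (Path.isSegment_comp h₂ b a₂ (by rw [← hda₂, add_tsub_cancel_left])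
      (by rw [hdb']) hc₂)]

/-- Competitors are eliminated one at a time: lengthening `c` keeps the products that already vanish
equal to zero. Only a competitor with the same endpoints as `f` and a different degree needs
aperiodicity. -/
theorem exists_forall_ghost_mul_path_mul_path_eq_zero (hΛ : Λ.IsAperiodic) {u v : Λ.Vertex}
    (f : u ⟶ v) (S : Finset Λ.Path) :
    ∃ (s : Λ.Vertex) (c : s ⟶ u), ∀ g ∈ S, g ≠ ⟨u, v, f⟩ →
      ghost R (c ≫ f) * (path R g.hom * path R c) = 0 := by
  classical
  induction S using Finset.induction_on with
  | empty => exact ⟨u, 𝟙 u, fun g hg => absurd hg (Finset.notMem_empty g)⟩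
  | insert g S hg ih =>
    obtain ⟨s, c, hc⟩ := ih
    suffices h : ∃ (r : Λ.Vertex) (b : r ⟶ s), g ≠ ⟨u, v, f⟩ →
        ghost R ((b ≫ c) ≫ f) * (path R g.hom * path R (b ≫ c)) = 0 by
      obtain ⟨r, b, hb⟩ := h
      refine ⟨r, b ≫ c, fun g' hg' hne => ?_⟩
      rcases Finset.mem_insert.mp hg' with rfl | hg'
      · exact hb hne
      · rw [Category.assoc, ← ghost_mul_ghost, ← path_mul_path, ← mul_assoc (path R g'.hom),
          mul_assoc, ← mul_assoc (ghost R (c ≫ f)), hc g' hg' hne, zero_mul, mul_zero]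
    obtain ⟨t, v', g⟩ := g
    by_cases ht : t = u
    · subst ht
      by_cases hv : v = v'
      · subst hv
        by_cases hd : Λ.degree f = Λ.degree g
        · refine ⟨s, 𝟙 s, fun hne => ?_⟩
          rw [← ghost_mul_ghost, mul_assoc, ← mul_assoc (ghost R f), ghost_mul_path_of_ne R hd,
            zero_mul, mul_zero]
          intro e
          exact hne (by rw [show f = g from eq_of_heq (Sigma.mk.inj e).2])
        · obtain ⟨r, b, hb⟩ := exists_ghost_mul_path_eq_zero R hΛ (f := c ≫ f) (g := c ≫ g) (by
            rw [Λ.degree_comp, Λ.degree_comp]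
            exact fun e => hd (add_right_cancel e))
          refine ⟨r, b, fun _ => ?_⟩
          rw [path_mul_path, Category.assoc, Category.assoc, hb]
      · refine ⟨s, 𝟙 s, fun _ => ?_⟩
        rw [← mul_assoc, mul_eq_zero_of_ne R (ghost_mul_p R _) (p_mul_path R g) hv, zero_mul]
    · refine ⟨s, 𝟙 s, fun _ => ?_⟩
      rw [mul_eq_zero_of_ne R (path_mul_p R g) (p_mul_path R _) ht, mul_zero]

variable {R}

theorem exists_mul_mul_eq_smul_p (hk : 0 < k) (hΛ : Λ.IsAperiodic) {a : Λ.KumjianPask R}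
    (ha : a ≠ 0) :
    ∃ (b c : Λ.KumjianPask R) (r : R) (v : Λ.Vertex), r ≠ 0 ∧ b * a * c = r • p R v := by
  obtain ⟨n, hn⟩ := exists_mul_path_mem_pathSpan a 0
  -- Adding `1` makes the degree nonzero, as `k > 0`, so that `p_v` may be expanded over paths of
  -- this degree.
  obtain ⟨u, v, g, hg, hag⟩ := exists_mul_path_ne_zero ha (n := n + 1) (fun h => by
    have := congrFun h ⟨0, hk⟩
    simp at this)
  have hmem := hn g (hg ▸ le_self_add)
  have hset : {a | ∃ f : Λ.Path, 0 ≤ f.deg ∧ path R f.hom = a} =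
      Set.range fun f : Λ.Path => path R f.hom := by
    ext a
    simp
  rw [pathSpan, hset, Finsupp.mem_span_range_iff_exists_finsupp] at hmem
  obtain ⟨c, hc⟩ := hmem
  -- Since `a s_g p_u = a s_g ≠ 0`, some term has source `u`. Its coefficient is nonzero by
  -- membership in the support, so linear independence of the `s_f` plays no role.
  have hsrc : ∃ f ∈ c.support, f.src = u := by
    by_contra! h
    refine hag ?_
    rw [← path_mul_p R g, ← mul_assoc, ← hc, Finsupp.sum, Finset.sum_mul]
    refine Finset.sum_eq_zero fun f hf => ?_
    rw [smul_mul_assoc, mul_eq_zero_of_ne R (path_mul_p R f.hom) (p_mul_self R u) (h f hf),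
      smul_zero]
  obtain ⟨⟨u', w, f⟩, hf, hu⟩ := hsrc
  obtain rfl : u' = u := hu
  obtain ⟨s, d, hd⟩ := exists_forall_ghost_mul_path_mul_path_eq_zero R hΛ f c.support
  refine ⟨ghost R (d ≫ f), path R g * path R d, c ⟨u', w, f⟩, s, Finsupp.mem_support_iff.mp hf, ?_⟩
  rw [← mul_assoc, mul_assoc _ a, ← hc, Finsupp.sum, mul_assoc, Finset.sum_mul, Finset.mul_sum,
    Finset.sum_eq_single_of_mem _ hf]
  · rw [smul_mul_assoc, mul_smul_comm, path_mul_path, ghost_mul_path_self]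
  · intro f' hf' hne
    rw [smul_mul_assoc, mul_smul_comm, hd f' hf' hne, smul_zero]

variable (I : TwoSidedIdeal (Λ.KumjianPask R))

theorem p_src_mem_of_p_rng_mem {u v : Λ.Vertex} (f : u ⟶ v) (h : p R v ∈ I) : p R u ∈ I := by
  rw [← ghost_mul_path_self R f, ← ghost_mul_p R f]
  exact I.mul_mem_right _ _ (I.mul_mem_left _ _ h)

theorem p_mem_of_forall_src_mem {v : Λ.Vertex} {n : Fin k → ℕ} (hn : n ≠ 0)
    (h : ∀ (u : Λ.Vertex) (f : u ⟶ v), Λ.degree f = n → p R u ∈ I) : p R v ∈ I := by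
  rw [p_eq_sum R v hn]
  refine sum_mem fun f hf => ?_
  rw [Set.Finite.mem_toFinset] at hf
  obtain ⟨u, v', f⟩ := f
  obtain ⟨hv, hd⟩ := hf
  obtain rfl : v' = v := hv
  rw [← path_mul_p R f]
  exact I.mul_mem_right _ _ (I.mul_mem_left _ _ (h u f hd))

/-- A vertex outside `I` has a path of degree `(1, …, 1)` into it from another vertex outside `I`;
iterating gives an infinite path. By cofinality it has a vertex `y(n)` with a path to `w`, hence in
`I`, while a vertex outside `I` has a path to `y(n)`. Membership passes from range to source, a
contradiction. -/
theorem forall_p_mem_of_isCofinal (hk : 0 < k) (hΛ : Λ.IsCofinal) {w : Λ.Vertex}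
    (hw : p R w ∈ I) (v : Λ.Vertex) : p R v ∈ I := by
  by_contra hv
  obtain ⟨y, hy⟩ := Ray.exists_of_forall_exists (fun v => p R v ∉ I) (fun v hv => by
    contrapose! hv
    exact p_mem_of_forall_src_mem I (n := 1)
      (fun h => one_ne_zero (congrFun h ⟨0, hk⟩)) hv) hv
  obtain ⟨n, ⟨f⟩⟩ := hΛ y.toInfinitePath w
  obtain ⟨u, hu, ⟨g⟩⟩ := hy n
  exact hu (p_src_mem_of_p_rng_mem I g (p_src_mem_of_p_rng_mem I f hw))

theorem isBasicallySimple_of_isCofinal_of_isAperiodic (hk : 0 < k) (hc : Λ.IsCofinal)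
    (ha : Λ.IsAperiodic) : IsBasicallySimple Λ R := by
  intro I hI
  by_cases h0 : ∀ a ∈ I, a = 0
  · exact Or.inl (le_bot_iff.mp fun a h => (TwoSidedIdeal.mem_bot _).mpr (h0 a h))
  · right
    push Not at h0
    obtain ⟨a, haI, ha0⟩ := h0
    obtain ⟨b, c, r, v, hr, hrv⟩ := exists_mul_mul_eq_smul_p hk ha ha0
    have hv : p R v ∈ I := hI v r hr (hrv ▸ I.mul_mem_right _ _ (I.mul_mem_left _ _ haI))
    refine top_le_iff.mp fun a _ => ?_
    obtain ⟨V, hV⟩ := exists_mul_sum_p_eq a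
    rw [← hV V subset_rfl]
    exact I.mul_mem_left _ _ (sum_mem fun u _ => forall_p_mem_of_isCofinal I hk hc hv u)

end Sufficiency

end KumjianPask

end KGraph

theorem theorem5p15 {k : ℕ} (hk : 0 < k) (Λ : KGraph.{u, w} k) [Λ.RowFinite] [Λ.NoSources]
    (R : Type x) [CommRing R] [Nontrivial R] :
    KGraph.KumjianPask.IsBasicallySimple Λ R ↔ Λ.IsCofinal ∧ Λ.IsAperiodic :=
  ⟨fun h => ⟨h.isCofinal, h.isAperiodic⟩,
    fun h => KGraph.KumjianPask.isBasicallySimple_of_isCofinal_of_isAperiodic hk h.1 h.2⟩
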